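/- **Setting.** Let $\mathbb S^2=\{x\in\mathbb R^3:\|x\|_2=1\}$ with $d(x,y)=\arccos\langle x,y\rangle$. For every $x\in\mathbb S^2$ fix an orthonormal basis $\eta_1^x,\eta_2^x$ of the tangent plane $T_x\mathbb S^2=x^\perp$ (no continuity in $x$ is required). For a unit tangent vector $v$ at $x$ let $\gamma_{x,v}(t)=\cos(t)\,x+\sin(t)\,v$, and for a function $f$ on $\mathbb S^2$ put $X_kf(y)=\frac{d}{dt}f(\gamma_{y,\eta_k^y}(t))\big|_{t=0}$, $k=1,2$; a superscript $X_k^y$ says that $X_k$ acts on the variable $y$. For $N\in\mathbb N_0$ let $n=\lfloor N/2\rfloor$ and let $J_N(x,y)=\widetilde J_N(d(x,y))$ be the Jackson kernel, where $$\widetilde J_N(\omega)=\frac{1}{(n+1)^4}\,\frac{\sin^4\big((n+1)\omega/2\big)}{\sin^4(\omega/2)},$$ continued by the value $1$ at the zeros of $\sin(\omega/2)$. Polar coordinates centered at $z\in\mathbb S^2$ are $\varphi(r,\theta)=\cos(r)\,z+\sin(r)\big(\cos(\theta)\,\eta_1^z+\sin(\theta)\,\eta_2^z\big)$. For $x\in\mathbb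 S^2\setminus\{z,-z\}$ let $r=d(x,z)\in(0,\pi)$ and $\theta$ be the coordinates of $x$, so that $x=\varphi(r,\theta)$. The Hessian matrix of a function $f$ at $x$ in these coordinates (with respect to the orthonormal basis $\partial_r,\ (\sin r)^{-1}\partial_\theta$ of $T_x\mathbb S^2$) is, with $F=f\circ\varphi$ and all derivatives taken at $(r,\theta)$, $$Hf(x)=\begin{pmatrix}\partial_r^2F & \frac{1}{\sin r}\partial_r\partial_\theta F\\[2pt] \frac{1}{\sin r}\partial_\theta\partial_rF & \frac{1}{\sin^2r}\partial_\theta^2F\end{pmatrix}-\frac{\partial_rF}{\sin^2 r}\begin{pmatrix}0&0\\0&-\sin r\cos r\end{pmatrix}-\frac{\partial_\theta F}{\sin r}\begin{pmatrix}0&\cot r\\ \cot r&0\end{pmatrix}.$$ Below, $HJ_N(x,y)$ and $HX_k^yJ_N(x,y)$ are the Hessian matrices at $x$, in polar coordinates centered at $z$, of the functions $J_N(\cdot,y)$ and $X_k^yJ_N(\cdot,y)$. **Theorem.** The function $\widetilde J_N$ is twice continuously differentiable, $X_k^yJ_N(x,y)$ exists for all $x,y\in\mathbb S^2$, and for all $y,z\in\mathbb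 S^2$ the functions $J_N(\cdot,y)$ and $X_k^yJ_N(\cdot,y)$ are twice continuously differentiable functions of the polar coordinates $(r,\theta)$ centered at $z$. Moreover: (a) If $x,y,z\in\mathbb S^2$ are pairwise different and $x\neq -z$, then for all $k,i,j\in\{1,2\}$ with $i\ne j$ $$|(HJ_N(x,y))_{ii}|\le\frac{16.5\,\pi^4}{(n+1)^2d(x,y)^4},\qquad |(HJ_N(x,y))_{ij}|\le\frac{14.5\,\pi^4}{(n+1)^2d(x,y)^4},$$ $$|(HX_k^yJ_N(x,y))_{ii}|\le\frac{103\,\pi^4}{(n+1)\,d(x,y)^4},\qquad |(HX_k^yJ_N(x,y))_{ij}|\le\frac{93.5\,\pi^4}{(n+1)\,d(x,y)^4}.$$ (b) Let $y=z$, $x\in\mathbb S^2\setminus\{z,-z\}$ and $d(x,z)\le\frac{\delta}{n+1}$ with $\delta\le\pi/4$. Then for all $k,i,j\in\{1,2\}$ with $i\neq j$ $$|\widetilde J_N''(0)-(HJ_N(x,z))_{ii}|\le\tfrac{3}{20}\delta^2(n+1)^2,\qquad |(HJ_N(x,z))_{ij}|\le\tfrac{3}{20}\delta^2(n+1)^2,$$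 $$|(HX_k^yJ_N(x,z))_{11}|\le\tfrac{3}{10}\delta(n+1)^3,\qquad |(HX_k^yJ_N(x,z))_{22}|\le\tfrac15\delta(n+1)^3,\qquad |(HX_k^yJ_N(x,z))_{ij}|\le\tfrac15\delta(n+1)^3.$$ -/

import Mathlib

noncomputable section

/-- The ambient Euclidean space `ℝ³`; points of the unit sphere `𝕊²` are the vectors of norm one. -/
abbrev E3 : Type := EuclideanSpace ℝ (Fin 3)

/-- The great-circle distance of two points of the unit sphere. -/
def sphDist (x y : E3) : ℝ := Real.arccos (inner ℝ x y)

/-- The geodesic `γ_{x,v}` of the sphere with `γ(0) = x` and `γ'(0) = v`, for `v` tangent at `x`. -/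
def sphGeodesic (x v : E3) (t : ℝ) : E3 :=
  Real.cos (‖v‖ * t) • x + Real.sin (‖v‖ * t) • (‖v‖⁻¹ • v)

/-- The exponential map of the sphere at `x`. -/
def sphExp (x v : E3) : E3 := sphGeodesic x v 1

/-- `η x = (η x 0, η x 1)` is an orthonormal basis of the tangent plane `{v | ⟨x, v⟩ = 0}` for every
point `x` of the sphere. No continuity in `x` and no orientation is required. -/
def IsTangentFrame (η : E3 → Fin 2 → E3) : Prop :=
  ∀ x : E3, ‖x‖ = 1 → Orthonormal ℝ (η x) ∧ ∀ k : Fin 2, inner ℝ x (η x k) = 0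

/-- Polar coordinates centred at `z`, with respect to the basis `η z` of the tangent plane at `z`. -/
def polarMap (η : E3 → Fin 2 → E3) (z : E3) (r θ : ℝ) : E3 :=
  sphExp z (r • (Real.cos θ • η z 0 + Real.sin θ • η z 1))

/-- The radial coordinate of `x`. -/
def polarR (z x : E3) : ℝ := sphDist x z

/-- The angular coordinate of `x`: the angle, normalized to `(-π, π]`, of the planar vector
`(⟨x, η₁ᶻ⟩, ⟨x, η₂ᶻ⟩)`. -/
def polarTheta (η : E3 → Fin 2 → E3) (z x : E3) : ℝ :=
  Complex.arg (⟨inner ℝ x (η z 0), inner ℝ x (η z 1)⟩ : ℂ)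

/-- The Christoffel symbols `Γ^r` of the metric `diag(1, sin² r)`. -/
def christoffelR (r : ℝ) : Matrix (Fin 2) (Fin 2) ℝ :=
  !![0, 0; 0, -(Real.sin r * Real.cos r)]

/-- The Christoffel symbols `Γ^θ` of the metric `diag(1, sin² r)`. -/
def christoffelTheta (r : ℝ) : Matrix (Fin 2) (Fin 2) ℝ :=
  !![0, Real.cot r; Real.cot r, 0]

/-- The Hessian matrix of a function given by `F (r, θ)` in polar coordinates, with respect to the
orthonormal tangent basis `∂_r`, `(sin r)⁻¹ ∂_θ`. -/
def polarHessianAt (F : ℝ → ℝ → ℝ) (r θ : ℝ) : Matrix (Fin 2) (Fin 2) ℝ :=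
  !![deriv (fun s => deriv (fun s' => F s' θ) s) r,
      1 / Real.sin r * deriv (fun s => deriv (fun τ => F s τ) θ) r;
     1 / Real.sin r * deriv (fun τ => deriv (fun s => F s τ) r) θ,
      1 / Real.sin r ^ 2 * deriv (fun τ => deriv (fun τ' => F r τ') τ) θ]
  - (1 / Real.sin r ^ 2 * deriv (fun s => F s θ) r) • christoffelR r
  - (1 / Real.sin r * deriv (fun τ => F r τ) θ) • christoffelTheta r

/-- The Hessian matrix `Hf(x)` of a function `f` on the sphere, in polar coordinates centred at
`z`, for `x ≠ z, -z`. Only the values of `f` on the sphere enter. -/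
def polarHessian (η : E3 → Fin 2 → E3) (z : E3) (f : E3 → ℝ) (x : E3) :
    Matrix (Fin 2) (Fin 2) ℝ :=
  polarHessianAt (fun r θ => f (polarMap η z r θ)) (polarR z x) (polarTheta η z x)

/-- The Jackson kernel as a function of one angle, with `n = ⌊N/2⌋`; the removable singularities
at the zeros of `sin (ω/2)` are filled with the limit value `1`. -/
def jacksonAngle (N : ℕ) (ω : ℝ) : ℝ :=
  if Real.sin (ω / 2) = 0 then 1
  else 1 / ((N / 2 : ℕ) + 1 : ℝ) ^ 4 *
    (Real.sin (((N / 2 : ℕ) + 1 : ℝ) * ω / 2) ^ 4 / Real.sin (ω / 2) ^ 4)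

/-- The Jackson kernel on the sphere. -/
def jackson (N : ℕ) (x y : E3) : ℝ := jacksonAngle N (sphDist x y)

/-- The derivative `X_k^y f` at the point `y` of a function `f` on the sphere, in the direction of
the basis vector `η y k`. -/
def tangentDeriv (η : E3 → Fin 2 → E3) (k : Fin 2) (f : E3 → ℝ) (y : E3) : ℝ :=
  deriv (fun t : ℝ => f (sphGeodesic y (η y k) t)) 0

/-- The derivative `X_k^y J_N(x, y)` of the Jackson kernel with respect to its second variable. -/
def jacksonDeriv (N : ℕ) (η : E3 → Fin 2 → E3) (k : Fin 2) (x y : E3) : ℝ :=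
  tangentDeriv η k (fun y' => jackson N x y') y

end

/-!
In the variable `x = cos ω` the Jackson kernel is a polynomial: with `m = n + 1` it is `P = G ^ 2`,
where `G` is the Fejér polynomial, characterized by `m ^ 2 (1 - x) G = 1 - T m` with the Chebyshev
polynomial `T m` (`fejerPoly_mul`, `jacksonAngle_eq`). On the sphere therefore
`J_N(x, y) = P ⟨x, y⟩` and `X_k^y J_N(x, y) = P' ⟨x, y⟩ ⟨x, η y k⟩`, so that all smoothness claims
are immediate, and the Hessian of a function `q(A) (κ + B)` with linear forms `A`, `B` is computed
once and for all in `polarHessianAt_polarForm`. Its entries only involve the first three derivatives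
of `P` at `⟨x, y⟩` and the coordinates of `y` and `η y k` in an orthonormal basis at `x`.

*Pairwise different points.* Bounds for the derivatives of `T m`, obtained from its differential
equation and its extremal values at `1`, pass to `G` through the derivatives of
`m ^ 2 (1 - x) G = 1 - T m`, then to `P` by the product rule (`jacksonPoly_derivative_bounds`), with
a factor `(1 - x) ^ (-2)`. Since `1 - cos d = 2 sin² (d / 2) ≥ 2 d² / π²`, this factor is at most
`π ^ 4 / (4 d ^ 4)`. The constants are large enough for the triangle inequality in every Hessian
entry.

*Near the centre.* For `y = z` the diagonal entries in the radial direction are the second and,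
up to a factor in `[-1, 1]`, the third derivative of the kernel `J` in the angle `ω`; the others are
simpler. Here the constants leave no room asymptotically. The polynomial `P` is a nonnegative
combination of Chebyshev polynomials (`jacksonPoly_mem`), hence its derivatives, and the
differential expression for the third derivative of `J`, attain their largest absolute value on
`[-1, 1]` at `x = 1`. There they are explicit: `P' 1 = (m² - 1) / 3` and
`P'' 1 = (m² - 1) (3 m² - 7) / 30`, so that the fourth derivative of `J` at `0`, which is
`P' 1 + 3 P'' 1`, is at most `3 m⁴ / 10`.
-/

section

open Polynomial
open Polynomial.Chebyshev hiding C C_mul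
open scoped NNReal

/-! ### The cone of nonnegative combinations of Chebyshev polynomials -/

/-- The convex cone of all nonnegative combinations of the Chebyshev polynomials `T n`; in the
variable `x = cos ω` these are the even trigonometric polynomials with nonnegative coefficients. -/
noncomputable def chebyshevCone : Submodule ℝ≥0 ℝ[X] :=
  Submodule.span ℝ≥0 (Set.range (T ℝ))

namespace chebyshevCone

theorem T_mem (k : ℤ) : T ℝ k ∈ chebyshevCone := Submodule.subset_span ⟨k, rfl⟩

theorem one_mem : (1 : ℝ[X]) ∈ chebyshevCone := by
  simpa using T_mem 0

theorem C_mul_mem {c : ℝ} (hc : 0 ≤ c) {p : ℝ[X]} (hp : p ∈ chebyshevCone) :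
    C c * p ∈ chebyshevCone := by
  have h := Submodule.smul_mem chebyshevCone (⟨c, hc⟩ : ℝ≥0) hp
  rwa [← smul_eq_C_mul]

theorem derivative_T_natCast_mem (n : ℕ) : derivative (T ℝ n) ∈ chebyshevCone := by
  have h := T_derivative_mem_span_T (R := ℝ) n
  generalize derivative (T ℝ n) = p at h ⊢
  induction h using Submodule.span_induction with
  | mem x hx =>
    obtain ⟨m, -, rfl⟩ := hx
    exact T_mem m
  | zero => exact zero_mem _
  | add x y _ _ hx hy => exact add_mem hx hy
  | smul a x _ hx => exact Submodule.smul_of_tower_mem _ a hx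

theorem derivative_mem {p : ℝ[X]} (hp : p ∈ chebyshevCone) :
    derivative p ∈ chebyshevCone := by
  induction hp using Submodule.span_induction with
  | mem x hx =>
    obtain ⟨k, rfl⟩ := hx
    rw [← T_natAbs]
    exact derivative_T_natCast_mem _
  | zero => simp
  | add x y _ _ hx hy => simpa using add_mem hx hy
  | smul a x _ hx =>
    rw [derivative_smul]
    exact Submodule.smul_mem _ a hx

theorem T_mul_T_mem (j k : ℤ) : T ℝ j * T ℝ k ∈ chebyshevCone := by
  have h : T ℝ j * T ℝ k = C (1 / 2) * (T ℝ (j + k) + T ℝ (j - k)) := by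
    rw [← T_mul_T, ← mul_assoc, ← mul_assoc, ← C_ofNat, ← C_mul]
    norm_num
  rw [h]
  exact C_mul_mem (by norm_num) (add_mem (T_mem _) (T_mem _))

theorem mul_mem {p q : ℝ[X]} (hp : p ∈ chebyshevCone) (hq : q ∈ chebyshevCone) :
    p * q ∈ chebyshevCone := by
  induction hp using Submodule.span_induction with
  | mem x hx =>
    obtain ⟨j, rfl⟩ := hx
    induction hq using Submodule.span_induction with
    | mem y hy =>
      obtain ⟨k, rfl⟩ := hy
      exact T_mul_T_mem j k
    | zero => simp
    | add x y _ _ hx hy => simpa [mul_add] using add_mem hx hy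
    | smul a x _ hx =>
      rw [mul_smul_comm]
      exact Submodule.smul_mem _ a hx
  | zero => simp
  | add x y _ _ hx hy => simpa [add_mul] using add_mem hx hy
  | smul a x _ hx =>
    rw [smul_mul_assoc]
    exact Submodule.smul_mem _ a hx

theorem abs_eval_le {p : ℝ[X]} (hp : p ∈ chebyshevCone) {x : ℝ} (hx : |x| ≤ 1) :
    |p.eval x| ≤ p.eval 1 := by
  induction hp using Submodule.span_induction with
  | mem y hy =>
    obtain ⟨k, rfl⟩ := hy
    simpa using abs_eval_T_real_le_one k hx
  | zero => simp
  | add p q _ _ hp hq =>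
    simp only [eval_add]
    exact (abs_add_le _ _).trans (add_le_add hp hq)
  | smul a p _ hp =>
    simp only [NNReal.smul_def, eval_smul, smul_eq_mul, abs_mul, NNReal.abs_eq]
    gcongr

theorem eval_one_nonneg {p : ℝ[X]} (hp : p ∈ chebyshevCone) : 0 ≤ p.eval 1 :=
  (abs_nonneg _).trans (abs_eval_le hp (x := 1) (by simp))

/-- The mean value theorem, with the derivative bounded by its value at `1`. -/
theorem eval_one_sub_eval_le {p : ℝ[X]} (hp : p ∈ chebyshevCone) {x : ℝ} (hx : |x| ≤ 1) :
    p.eval 1 - p.eval x ≤ (1 - x) * (derivative p).eval 1 := by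
  obtain ⟨hx1, hx2⟩ := abs_le.1 hx
  rcases hx2.eq_or_lt with rfl | hlt
  · simp
  obtain ⟨c, hc, h⟩ := exists_deriv_eq_slope (fun y => p.eval y) hlt p.continuous.continuousOn
    p.differentiable.differentiableOn
  rw [Polynomial.deriv, eq_div_iff (by linarith)] at h
  have hc' : (derivative p).eval c ≤ (derivative p).eval 1 :=
    (le_abs_self _).trans
      (abs_eval_le (derivative_mem hp) (abs_le.2 ⟨by linarith [hc.1], hc.2.le⟩))
  rw [← h, mul_comm]
  exact mul_le_mul_of_nonneg_left hc' (by linarith)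

/-- In the variable `x = cos ω` the expression on the left is the third derivative in `ω`, up to
the factor `-sin ω`; on `T k` it equals `-k ^ 2 * T k'`, which is largest at `x = 1`. -/
theorem abs_thirdOrder_le {p : ℝ[X]} (hp : p ∈ chebyshevCone) {x : ℝ} (hx : |x| ≤ 1) :
    |(1 - x ^ 2) * (derivative^[3] p).eval x - 3 * x * (derivative^[2] p).eval x
        - (derivative p).eval x| ≤
      3 * (derivative^[2] p).eval 1 + (derivative p).eval 1 := by
  induction hp using Submodule.span_induction with
  | mem y hy =>
    obtain ⟨k, rfl⟩ := hy
    have h0 := one_sub_X_sq_mul_iterate_derivative_T_eval k 1 x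
    have h1 := iterate_derivative_T_eval_one_recurrence (R := ℝ) k 1
    have hb := abs_iterate_derivative_T_real_le k 1 hx
    simp only [Function.iterate_one, Nat.cast_one, one_add_one_eq_two] at h0 h1 hb
    norm_num only at h0 h1
    have e1 : (1 - x ^ 2) * (derivative^[3] (T ℝ k)).eval x
        - 3 * x * (derivative^[2] (T ℝ k)).eval x - (derivative (T ℝ k)).eval x
        = -((k : ℝ) ^ 2 * (derivative (T ℝ k)).eval x) := by
      linear_combination h0
    have e2 : 3 * (derivative^[2] (T ℝ k)).eval 1 + (derivative (T ℝ k)).eval 1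
        = (k : ℝ) ^ 2 * (derivative (T ℝ k)).eval 1 := by
      linear_combination h1
    rw [e1, e2, abs_neg, abs_mul, abs_of_nonneg (sq_nonneg (k : ℝ))]
    gcongr
  | zero => simp
  | add p q _ _ hp hq =>
    simp only [iterate_map_add, derivative_add, eval_add]
    refine le_trans (le_of_eq ?_) ((abs_add_le _ _).trans ((add_le_add hp hq).trans_eq ?_))
    · congr 1
      ring
    · ring
  | smul a p _ hp =>
    simp only [NNReal.smul_def, iterate_derivative_smul, derivative_smul, eval_smul, smul_eq_mul]
    have h := mul_le_mul_of_nonneg_left hp a.2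
    rw [← abs_of_nonneg a.2, ← abs_mul, abs_of_nonneg a.2] at h
    refine le_trans (le_of_eq ?_) (h.trans_eq ?_)
    · congr 1
      simp only [NNReal.val_eq_coe]
      ring
    · simp only [NNReal.val_eq_coe]
      ring

end chebyshevCone

/-! ### The Fejér polynomial -/

/-- The Fejér kernel of order `m` in the variable `x = cos ω`, normalized to the value `1` at
`x = 1`, as a mean of Dirichlet kernels; see `fejerPoly_mul`. -/
noncomputable def fejerPoly (m : ℕ) : ℝ[X] :=
  C (1 / (m : ℝ) ^ 2) *
    ∑ j ∈ Finset.range m, (1 + 2 * ∑ i ∈ Finset.range j, T ℝ ((i : ℤ) + 1))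

theorem one_sub_X_mul_dirichlet (j : ℕ) :
    (1 - X) * (1 + 2 * ∑ i ∈ Finset.range j, T ℝ ((i : ℤ) + 1)) =
      T ℝ j - T ℝ ((j : ℤ) + 1) := by
  induction j with
  | zero => simp
  | succ j ih =>
    rw [Finset.sum_range_succ]
    have h := T_add_two ℝ (j : ℤ)
    push_cast
    rw [show (j : ℤ) + 1 + 1 = j + 2 by ring, h]
    linear_combination ih

theorem one_sub_X_mul_sum_dirichlet (m : ℕ) :
    (1 - X) * ∑ j ∈ Finset.range m, (1 + 2 * ∑ i ∈ Finset.range j, T ℝ ((i : ℤ) + 1)) =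
      1 - T ℝ m := by
  induction m with
  | zero => simp
  | succ m ih =>
    rw [Finset.sum_range_succ, mul_add, ih, one_sub_X_mul_dirichlet]
    push_cast
    ring

theorem fejerPoly_mul {m : ℕ} (hm : m ≠ 0) :
    C ((m : ℝ) ^ 2) * ((1 - X) * fejerPoly m) = 1 - T ℝ m := by
  have hm' : (m : ℝ) ≠ 0 := Nat.cast_ne_zero.2 hm
  rw [fejerPoly, mul_left_comm (1 - X), one_sub_X_mul_sum_dirichlet, ← mul_assoc, ← C_mul,
    mul_one_div_cancel (pow_ne_zero 2 hm'), C_1, one_mul]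

theorem fejerPoly_mem (m : ℕ) : fejerPoly m ∈ chebyshevCone := by
  refine chebyshevCone.C_mul_mem (by positivity) (sum_mem fun j _ => ?_)
  refine add_mem chebyshevCone.one_mem ?_
  rw [two_mul]
  have h : ∑ i ∈ Finset.range j, T ℝ ((i : ℤ) + 1) ∈ chebyshevCone :=
    sum_mem fun i _ => chebyshevCone.T_mem _
  exact add_mem h h

/-- The identity `m ^ 2 (1 - x) G = 1 - T m` for the Fejér polynomial `G`, differentiated `k + 1`
times. -/
theorem fejerPoly_iterate_derivative_eval {m : ℕ} (hm : m ≠ 0) (k : ℕ) (x : ℝ) :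
    (m : ℝ) ^ 2 * ((1 - x) * (derivative^[k + 1] (fejerPoly m)).eval x
      - (k + 1) * (derivative^[k] (fejerPoly m)).eval x) =
      -(derivative^[k + 1] (T ℝ m)).eval x := by
  have key : C ((m : ℝ) ^ 2) * ((1 - X) * derivative^[k + 1] (fejerPoly m)
      - C ((k : ℝ) + 1) * derivative^[k] (fejerPoly m)) = -derivative^[k + 1] (T ℝ m) := by
    induction k with
    | zero =>
      have h := congrArg derivative (fejerPoly_mul hm)
      simp only [derivative_mul, derivative_C, derivative_sub, derivative_one, derivative_X] at h
      simp only [Function.iterate_one, Function.iterate_zero, id, Nat.cast_zero, zero_add, C_1]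
      linear_combination h
    | succ k ih =>
      have h := congrArg derivative ih
      simp only [derivative_mul, derivative_C, derivative_sub, derivative_one, derivative_X,
        derivative_neg, ← Function.iterate_succ_apply' derivative] at h
      have e : C ((k + 1 : ℕ) + 1 : ℝ) = C ((k : ℝ) + 1) + 1 := by
        rw [← C_1, ← C_add]
        push_cast
        rfl
      rw [e]
      linear_combination h
  have h := congrArg (eval x) key
  simpa using h

theorem fejerPoly_eval_mul {m : ℕ} (hm : m ≠ 0) (x : ℝ) :
    (m : ℝ) ^ 2 * ((1 - x) * (fejerPoly m).eval x) = 1 - (T ℝ m).eval x := by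
  simpa using congrArg (eval x) (fejerPoly_mul hm)

theorem fejerPoly_eval_one {m : ℕ} (hm : m ≠ 0) : (fejerPoly m).eval 1 = 1 := by
  have hm' : (m : ℝ) ≠ 0 := Nat.cast_ne_zero.2 hm
  have h := fejerPoly_iterate_derivative_eval hm 0 1
  simp only [sub_self, zero_mul, derivative_T_eval_one, Function.iterate_zero, id, zero_add,
    Function.iterate_one, Nat.cast_zero] at h
  apply mul_left_cancel₀ (pow_ne_zero 2 hm')
  push_cast at h
  linear_combination -h

theorem derivative_fejerPoly_eval_one {m : ℕ} (hm : m ≠ 0) :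
    (derivative (fejerPoly m)).eval 1 = ((m : ℝ) ^ 2 - 1) / 6 := by
  have hm' : (m : ℝ) ≠ 0 := Nat.cast_ne_zero.2 hm
  have h := fejerPoly_iterate_derivative_eval hm 1 1
  have h2 := iterate_derivative_T_eval_one_recurrence (R := ℝ) m 1
  simp only [Function.iterate_one, derivative_T_eval_one] at h h2
  apply mul_left_cancel₀ (pow_ne_zero 2 hm')
  push_cast at h h2
  linear_combination (-1 / 2 : ℝ) * h + (1 / 6 : ℝ) * h2

theorem derivative_two_fejerPoly_eval_one {m : ℕ} (hm : m ≠ 0) :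
    (derivative^[2] (fejerPoly m)).eval 1 = ((m : ℝ) ^ 2 - 1) * ((m : ℝ) ^ 2 - 4) / 45 := by
  have hm' : (m : ℝ) ≠ 0 := Nat.cast_ne_zero.2 hm
  have h := fejerPoly_iterate_derivative_eval hm 2 1
  have h2 := iterate_derivative_T_eval_one_recurrence (R := ℝ) m 1
  have h3 := iterate_derivative_T_eval_one_recurrence (R := ℝ) m 2
  simp only [Function.iterate_one, derivative_T_eval_one] at h h2 h3
  apply mul_left_cancel₀ (pow_ne_zero 2 hm')
  push_cast at h h2 h3
  linear_combination (-1 / 3 : ℝ) * h + (1 / 15 : ℝ) * h3 + ((m : ℝ) ^ 2 - 4) / 45 * h2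

/-! ### The Jackson polynomial -/

/-- The Jackson kernel in the variable `x = cos ω`: the square of the Fejér polynomial. -/
noncomputable def jacksonPoly (m : ℕ) : ℝ[X] := fejerPoly m * fejerPoly m

theorem jacksonPoly_mem (m : ℕ) : jacksonPoly m ∈ chebyshevCone :=
  chebyshevCone.mul_mem (fejerPoly_mem m) (fejerPoly_mem m)

theorem derivative_jacksonPoly (m : ℕ) :
    derivative (jacksonPoly m) = 2 * (fejerPoly m * derivative (fejerPoly m)) := by
  rw [jacksonPoly, derivative_mul]
  ring

theorem derivative_two_jacksonPoly (m : ℕ) :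
    derivative^[2] (jacksonPoly m) = 2 * (derivative (fejerPoly m) ^ 2 +
      fejerPoly m * derivative^[2] (fejerPoly m)) := by
  rw [Function.iterate_succ_apply', Function.iterate_one, derivative_jacksonPoly]
  simp [derivative_mul]
  ring

theorem derivative_three_jacksonPoly (m : ℕ) :
    derivative^[3] (jacksonPoly m) = 6 * (derivative (fejerPoly m) *
      derivative^[2] (fejerPoly m)) + 2 * (fejerPoly m * derivative^[3] (fejerPoly m)) := by
  rw [Function.iterate_succ_apply', derivative_two_jacksonPoly]
  simp [derivative_mul, derivative_pow, ← C_ofNat]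
  simp only [C_ofNat]
  ring

theorem derivative_jacksonPoly_eval_one {m : ℕ} (hm : m ≠ 0) :
    (derivative (jacksonPoly m)).eval 1 = ((m : ℝ) ^ 2 - 1) / 3 := by
  rw [derivative_jacksonPoly]
  simp [fejerPoly_eval_one hm, derivative_fejerPoly_eval_one hm]
  ring

theorem derivative_two_jacksonPoly_eval_one {m : ℕ} (hm : m ≠ 0) :
    (derivative^[2] (jacksonPoly m)).eval 1 =
      ((m : ℝ) ^ 2 - 1) * (3 * (m : ℝ) ^ 2 - 7) / 30 := by
  have h := derivative_two_fejerPoly_eval_one hm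
  rw [derivative_two_jacksonPoly]
  simp only [eval_mul, eval_add, eval_pow, h, fejerPoly_eval_one hm,
    derivative_fejerPoly_eval_one hm, eval_ofNat]
  ring

/-! ### Pointwise bounds away from `x = 1` -/

theorem one_sub_sq_mul_derivative_T_sq (m : ℕ) {x : ℝ} (hx : |x| ≤ 1) :
    (1 - x ^ 2) * (derivative (T ℝ m)).eval x ^ 2 =
      (m : ℝ) ^ 2 * (1 - (T ℝ m).eval x ^ 2) := by
  obtain ⟨h1, h2⟩ := abs_le.1 hx
  obtain ⟨θ, rfl⟩ : ∃ θ, Real.cos θ = x := ⟨_, Real.cos_arccos h1 h2⟩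
  have hU := U_real_cos θ ((m : ℤ) - 1)
  rw [T_derivative_eq_U, T_real_cos, ← Real.sin_sq]
  simp only [eval_mul, eval_intCast]
  push_cast at hU ⊢
  rw [sub_add_cancel] at hU
  have h3 := Real.sin_sq_add_cos_sq (m * θ)
  calc _ = (m : ℝ) ^ 2 * ((U ℝ ((m : ℤ) - 1)).eval (Real.cos θ) * Real.sin θ) ^ 2 := by ring
    _ = _ := by
      rw [hU]
      linear_combination (m : ℝ) ^ 2 * h3

/-- Bounds with powers of `s = √(1 - x²)` as weights. The factor `s ^ 2` is removed by the
differential equation of `T m`; bounds without weight are the extremal values at `x = 1`, and the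
second derivative with the weight `s` lies between these two. -/
theorem chebyshevT_derivative_bounds {m : ℕ} (hm : m ≠ 0) {x s : ℝ} (hx : |x| ≤ 1)
    (hs : 0 ≤ s) (hsx : s ^ 2 = 1 - x ^ 2) :
    |(derivative (T ℝ m)).eval x| ≤ (m : ℝ) ^ 2 ∧
    s * |(derivative (T ℝ m)).eval x| ≤ m ∧
    s ^ 2 * |(derivative^[2] (T ℝ m)).eval x| ≤ 2 * (m : ℝ) ^ 2 ∧
    s * |(derivative^[2] (T ℝ m)).eval x| ≤ (m : ℝ) ^ 3 ∧
    s * (s ^ 2 * |(derivative^[3] (T ℝ m)).eval x|) ≤ 4 * (m : ℝ) ^ 3 := by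
  have hm1 : (1 : ℝ) ≤ m := by exact_mod_cast Nat.one_le_iff_ne_zero.2 hm
  have hsq := one_sub_sq_mul_derivative_T_sq m hx
  have hT := abs_eval_T_real_le_one m hx
  have hT1 := abs_iterate_derivative_T_real_le m 1 hx
  have hT2 := abs_iterate_derivative_T_real_le m 2 hx
  have ode2 := one_sub_X_sq_mul_iterate_derivative_T_eval (R := ℝ) m 0 x
  have ode3 := one_sub_X_sq_mul_iterate_derivative_T_eval (R := ℝ) m 1 x
  have e2 := iterate_derivative_T_eval_one_recurrence (R := ℝ) m 1
  simp only [Function.iterate_one, Function.iterate_zero, id, zero_add, derivative_T_eval_one]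
    at hT1 ode2 ode3 e2
  push_cast at hT1 ode2 ode3 e2
  norm_num only at ode2 ode3 e2
  rw [← hsx] at hsq ode2 ode3
  set t0 := (T ℝ m).eval x
  set t1 := (derivative (T ℝ m)).eval x
  set t2 := (derivative^[2] (T ℝ m)).eval x
  set t3 := (derivative^[3] (T ℝ m)).eval x
  have hs1 : s * |t1| ≤ m := by
    refine abs_le_of_sq_le_sq' ?_ (by positivity) |>.2
    rw [mul_pow, sq_abs, hsq]
    nlinarith [sq_nonneg t0, sq_nonneg (m : ℝ)]
  have hs2 : s ^ 2 * |t2| ≤ 2 * (m : ℝ) ^ 2 := by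
    rw [← abs_of_nonneg (sq_nonneg s), ← abs_mul, ode2]
    calc |1 * x * t1 - ((m : ℝ) ^ 2 - 0) * t0|
        ≤ |1 * x * t1| + |((m : ℝ) ^ 2 - 0) * t0| := abs_sub _ _
      _ = |x| * |t1| + (m : ℝ) ^ 2 * |t0| := by
          rw [one_mul, sub_zero, abs_mul, abs_mul, abs_of_nonneg (sq_nonneg (m : ℝ))]
      _ ≤ 1 * (m : ℝ) ^ 2 + (m : ℝ) ^ 2 * 1 := by gcongr
      _ = _ := by ring
  -- the geometric mean of the bounds for `s ^ 2 |t2|` and for `|t2|`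
  have hs3 : s * |t2| ≤ (m : ℝ) ^ 3 := by
    refine abs_le_of_sq_le_sq' ?_ (by positivity) |>.2
    have h : |t2| ≤ (m : ℝ) ^ 4 / 3 := hT2.trans (by nlinarith [sq_nonneg (m : ℝ)])
    calc (s * |t2|) ^ 2 = (s ^ 2 * |t2|) * |t2| := by ring
      _ ≤ (2 * (m : ℝ) ^ 2) * ((m : ℝ) ^ 4 / 3) := by gcongr
      _ ≤ ((m : ℝ) ^ 3) ^ 2 := by nlinarith [pow_nonneg (zero_le_one.trans hm1) 6]
  refine ⟨hT1, hs1, hs2, hs3, ?_⟩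
  have h3 : s ^ 2 * |t3| ≤ 3 * |t2| + (m : ℝ) ^ 2 * |t1| := by
    rw [← abs_of_nonneg (sq_nonneg s), ← abs_mul, ode3]
    calc |3 * x * t2 - ((m : ℝ) ^ 2 - 1) * t1|
        ≤ |3 * x * t2| + |((m : ℝ) ^ 2 - 1) * t1| := abs_sub _ _
      _ = 3 * |x| * |t2| + ((m : ℝ) ^ 2 - 1) * |t1| := by
          rw [abs_mul, abs_mul, abs_mul,
            abs_of_nonneg (show (0 : ℝ) ≤ (m : ℝ) ^ 2 - 1 by nlinarith)]
          norm_num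
      _ ≤ 3 * 1 * |t2| + (m : ℝ) ^ 2 * |t1| := by
          gcongr
          linarith
      _ = _ := by ring
  calc s * (s ^ 2 * |t3|) ≤ s * (3 * |t2| + (m : ℝ) ^ 2 * |t1|) := by gcongr
    _ = 3 * (s * |t2|) + (m : ℝ) ^ 2 * (s * |t1|) := by ring
    _ ≤ 3 * (m : ℝ) ^ 3 + (m : ℝ) ^ 2 * m := by gcongr
    _ = _ := by ring

/-- The derivatives of `m ^ 2 (1 - x) G = 1 - T m` express `1 - x` times a derivative of `G` by the
preceding one and by a derivative of `T m`; `s ^ 2 = (1 - x) (1 + x)` allows the preceding estimate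
to be used again. -/
theorem fejerPoly_derivative_bounds {m : ℕ} (hm : m ≠ 0) {x s : ℝ} (hx : |x| ≤ 1) (hx1 : x < 1)
    (hs : 0 ≤ s) (hsx : s ^ 2 = 1 - x ^ 2) :
    (1 - x) * |(fejerPoly m).eval x| ≤ 2 / (m : ℝ) ^ 2 ∧
    (1 - x) * |(derivative (fejerPoly m)).eval x| ≤ 2 ∧
    s * ((1 - x) * |(derivative (fejerPoly m)).eval x|) ≤ 3 / m ∧
    s ^ 2 * ((1 - x) * |(derivative^[2] (fejerPoly m)).eval x|) ≤ 10 ∧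
    s * ((1 - x) * |(derivative^[2] (fejerPoly m)).eval x|) ≤ 3 * m ∧
    s * (s ^ 2 * ((1 - x) * |(derivative^[3] (fejerPoly m)).eval x|)) ≤ 22 * m := by
  have hm1 : (1 : ℝ) ≤ m := by exact_mod_cast Nat.one_le_iff_ne_zero.2 hm
  have hm0 : (0 : ℝ) < m := by linarith
  have hu : 0 < 1 - x := by linarith
  have hx' : 0 ≤ 1 + x := by linarith [(abs_le.1 hx).1]
  have hsu : s ^ 2 = (1 + x) * (1 - x) := by rw [hsx]; ring
  have hT := abs_le.1 (abs_eval_T_real_le_one m hx)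
  obtain ⟨b1, b2, b3, b4, b5⟩ := chebyshevT_derivative_bounds hm hx hs hsx
  have r0 := fejerPoly_eval_mul hm x
  have r1 := fejerPoly_iterate_derivative_eval hm 0 x
  have r2 := fejerPoly_iterate_derivative_eval hm 1 x
  have r3 := fejerPoly_iterate_derivative_eval hm 2 x
  have c0 := chebyshevCone.abs_eval_le (fejerPoly_mem m) hx
  have c1 := chebyshevCone.abs_eval_le (chebyshevCone.derivative_mem (fejerPoly_mem m)) hx
  rw [fejerPoly_eval_one hm] at c0
  rw [derivative_fejerPoly_eval_one hm] at c1
  simp only [Function.iterate_one, Function.iterate_zero, id, zero_add, Nat.cast_zero,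
    Nat.cast_one, Nat.cast_ofNat, Nat.reduceAdd] at r1 r2 r3
  set t0 := (T ℝ m).eval x
  set t1 := (derivative (T ℝ m)).eval x
  set t2 := (derivative^[2] (T ℝ m)).eval x
  set t3 := (derivative^[3] (T ℝ m)).eval x
  set g0 := (fejerPoly m).eval x
  set g1 := (derivative (fejerPoly m)).eval x
  set g2 := (derivative^[2] (fejerPoly m)).eval x
  set g3 := (derivative^[3] (fejerPoly m)).eval x
  have hM : (0 : ℝ) < (m : ℝ) ^ 2 := by positivity
  have uabs : ∀ y : ℝ, (1 - x) * |y| = |(1 - x) * y| := fun y => by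
    rw [abs_mul, abs_of_pos hu]
  -- the relations `m² ((1 - x) g_{k+1} - (k + 1) g_k) = -t_{k+1}`, solved for the leading term
  have step : ∀ k a b t : ℝ, 0 ≤ k → (m : ℝ) ^ 2 * ((1 - x) * a - k * b) = -t →
      (1 - x) * |a| ≤ k * |b| + |t| / (m : ℝ) ^ 2 := by
    intro k a b t hk h
    have e : (1 - x) * a = k * b + -(t / (m : ℝ) ^ 2) := by
      field_simp
      linarith
    rw [uabs, e]
    refine (abs_add_le _ _).trans_eq ?_
    rw [abs_neg, abs_div, abs_of_pos hM, abs_mul, abs_of_nonneg hk]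
  have s1 := step 1 g1 g0 t1 (by norm_num) (by linarith)
  have s2 := step 2 g2 g1 t2 (by norm_num) (by linarith)
  have s3 := step 3 g3 g2 t3 (by norm_num) (by linarith)
  have a0 : (1 - x) * |g0| ≤ 2 / (m : ℝ) ^ 2 := by
    rw [uabs, le_div_iff₀ hM, ← abs_of_pos hM, ← abs_mul, mul_comm, r0, abs_le]
    exact ⟨by linarith [hT.2], by linarith [hT.1]⟩
  have a1 : (1 - x) * |g1| ≤ 2 := by
    have : |t1| / (m : ℝ) ^ 2 ≤ 1 := (div_le_one hM).2 b1
    linarith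
  have hsg0 : s * |g0| ≤ 2 / m := by
    refine abs_le_of_sq_le_sq' ?_ (by positivity) |>.2
    calc (s * |g0|) ^ 2 = (1 + x) * ((1 - x) * |g0|) * |g0| := by rw [mul_pow, hsu]; ring
      _ ≤ 2 * (2 / (m : ℝ) ^ 2) * 1 := by gcongr; linarith
      _ = (2 / m) ^ 2 := by ring
  have a2 : s * ((1 - x) * |g1|) ≤ 3 / m := by
    calc s * ((1 - x) * |g1|) ≤ s * (1 * |g0| + |t1| / (m : ℝ) ^ 2) := by gcongr
      _ = s * |g0| + (s * |t1|) / (m : ℝ) ^ 2 := by ring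
      _ ≤ 2 / m + m / (m : ℝ) ^ 2 := by gcongr
      _ = 3 / m := by field_simp; norm_num
  have a3 : s ^ 2 * ((1 - x) * |g2|) ≤ 10 := by
    calc s ^ 2 * ((1 - x) * |g2|) ≤ s ^ 2 * (2 * |g1| + |t2| / (m : ℝ) ^ 2) := by gcongr
      _ = 2 * ((1 + x) * ((1 - x) * |g1|)) + (s ^ 2 * |t2|) / (m : ℝ) ^ 2 := by rw [hsu]; ring
      _ ≤ 2 * (2 * 2) + (2 * (m : ℝ) ^ 2) / (m : ℝ) ^ 2 := by gcongr; linarith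
      _ = 10 := by field_simp; norm_num
  have hsg1 : s * |g1| ≤ m := by
    refine abs_le_of_sq_le_sq' ?_ (by positivity) |>.2
    calc (s * |g1|) ^ 2 = (1 + x) * ((1 - x) * |g1|) * |g1| := by rw [mul_pow, hsu]; ring
      _ ≤ 2 * 2 * (((m : ℝ) ^ 2 - 1) / 6) := by gcongr; linarith
      _ ≤ (m : ℝ) ^ 2 := by nlinarith
  have a4 : s * ((1 - x) * |g2|) ≤ 3 * m := by
    calc s * ((1 - x) * |g2|) ≤ s * (2 * |g1| + |t2| / (m : ℝ) ^ 2) := by gcongr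
      _ = 2 * (s * |g1|) + (s * |t2|) / (m : ℝ) ^ 2 := by ring
      _ ≤ 2 * m + (m : ℝ) ^ 3 / (m : ℝ) ^ 2 := by gcongr
      _ = 3 * m := by field_simp; norm_num
  refine ⟨a0, a1, a2, a3, a4, ?_⟩
  calc s * (s ^ 2 * ((1 - x) * |g3|)) ≤ s * (s ^ 2 * (3 * |g2| + |t3| / (m : ℝ) ^ 2)) := by gcongr
    _ = 3 * ((1 + x) * (s * ((1 - x) * |g2|))) + s * (s ^ 2 * |t3|) / (m : ℝ) ^ 2 := by
        rw [hsu]; ring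
    _ ≤ 3 * (2 * (3 * m)) + 4 * (m : ℝ) ^ 3 / (m : ℝ) ^ 2 := by gcongr; linarith
    _ = 22 * m := by field_simp; norm_num

theorem jacksonPoly_derivative_bounds {m : ℕ} (hm : m ≠ 0) {x s : ℝ} (hx : |x| ≤ 1) (hx1 : x < 1)
    (hs : 0 ≤ s) (hsx : s ^ 2 = 1 - x ^ 2) :
    |(derivative (jacksonPoly m)).eval x| ≤ 8 / ((m : ℝ) ^ 2 * (1 - x) ^ 2) ∧
    s ^ 2 * |(derivative^[2] (jacksonPoly m)).eval x| ≤ 58 / ((m : ℝ) ^ 2 * (1 - x) ^ 2) ∧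
    s * |(derivative^[2] (jacksonPoly m)).eval x| ≤ 24 / (m * (1 - x) ^ 2) ∧
    s * (s ^ 2 * |(derivative^[3] (jacksonPoly m)).eval x|) ≤ 268 / (m * (1 - x) ^ 2) := by
  have hm1 : (1 : ℝ) ≤ m := by exact_mod_cast Nat.one_le_iff_ne_zero.2 hm
  have hm0 : (0 : ℝ) < m := by linarith
  have hu : 0 < 1 - x := by linarith
  obtain ⟨a0, a1, a2, a3, a4, a5⟩ := fejerPoly_derivative_bounds hm hx hx1 hs hsx
  rw [derivative_jacksonPoly, derivative_two_jacksonPoly, derivative_three_jacksonPoly]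
  simp only [eval_mul, eval_add, eval_pow, eval_ofNat]
  set g0 := (fejerPoly m).eval x
  set g1 := (derivative (fejerPoly m)).eval x
  set g2 := (derivative^[2] (fejerPoly m)).eval x
  set g3 := (derivative^[3] (fejerPoly m)).eval x
  set u := 1 - x
  have p2 : |2 * (g1 ^ 2 + g0 * g2)| ≤ 2 * (|g1| ^ 2 + |g0| * |g2|) := by
    rw [abs_mul, abs_two]
    gcongr
    refine (abs_add_le _ _).trans_eq ?_
    rw [abs_mul, abs_pow]
  have p3 : |6 * (g1 * g2) + 2 * (g0 * g3)| ≤ 6 * (|g1| * |g2|) + 2 * (|g0| * |g3|) := by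
    refine (abs_add_le _ _).trans_eq ?_
    simp only [abs_mul]
    norm_num
  refine ⟨?_, ?_, ?_, ?_⟩ <;> rw [le_div_iff₀ (by positivity)]
  · rw [abs_mul, abs_mul, abs_two]
    calc 2 * (|g0| * |g1|) * ((m : ℝ) ^ 2 * u ^ 2)
        = 2 * (m : ℝ) ^ 2 * ((u * |g0|) * (u * |g1|)) := by ring
      _ ≤ 2 * (m : ℝ) ^ 2 * ((2 / (m : ℝ) ^ 2) * 2) := by gcongr
      _ = 8 := by field_simp; norm_num
  · calc s ^ 2 * |2 * (g1 ^ 2 + g0 * g2)| * ((m : ℝ) ^ 2 * u ^ 2)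
        ≤ s ^ 2 * (2 * (|g1| ^ 2 + |g0| * |g2|)) * ((m : ℝ) ^ 2 * u ^ 2) := by gcongr
      _ = 2 * (m : ℝ) ^ 2 * ((s * (u * |g1|)) ^ 2 + (u * |g0|) * (s ^ 2 * (u * |g2|))) := by ring
      _ ≤ 2 * (m : ℝ) ^ 2 * ((3 / m) ^ 2 + (2 / (m : ℝ) ^ 2) * 10) := by gcongr
      _ = 58 := by field_simp; norm_num
  · calc s * |2 * (g1 ^ 2 + g0 * g2)| * (m * u ^ 2)
        ≤ s * (2 * (|g1| ^ 2 + |g0| * |g2|)) * (m * u ^ 2) := by gcongr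
      _ = 2 * m * ((s * (u * |g1|)) * (u * |g1|) + (u * |g0|) * (s * (u * |g2|))) := by ring
      _ ≤ 2 * m * ((3 / m) * 2 + (2 / (m : ℝ) ^ 2) * (3 * m)) := by gcongr
      _ = 24 := by field_simp; norm_num
  · calc s * (s ^ 2 * |6 * (g1 * g2) + 2 * (g0 * g3)|) * (m * u ^ 2)
        ≤ s * (s ^ 2 * (6 * (|g1| * |g2|) + 2 * (|g0| * |g3|))) * (m * u ^ 2) := by gcongr
      _ = m * (6 * ((s * (u * |g1|)) * (s ^ 2 * (u * |g2|)))
            + 2 * ((u * |g0|) * (s * (s ^ 2 * (u * |g3|))))) := by ring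
      _ ≤ m * (6 * ((3 / m) * 10) + 2 * ((2 / (m : ℝ) ^ 2) * (22 * m))) := by gcongr
      _ = 268 := by field_simp; norm_num

/-! ### Hessians in polar coordinates -/

/-- The restriction of a linear form to the sphere in polar coordinates: `v` lists its values at
the centre and at the two basis vectors of the tangent plane there. -/
noncomputable def polarForm (v : Fin 3 → ℝ) (r θ : ℝ) : ℝ :=
  Real.cos r * v 0 + Real.sin r * (Real.cos θ * v 1 + Real.sin θ * v 2)

/-- The value of the linear form `v` at the unit tangent vector `∂_r`. -/
noncomputable def polarFormR (v : Fin 3 → ℝ) (r θ : ℝ) : ℝ :=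
  -Real.sin r * v 0 + Real.cos r * (Real.cos θ * v 1 + Real.sin θ * v 2)

/-- The value of the linear form `v` at the unit tangent vector `(sin r)⁻¹ ∂_θ`. -/
noncomputable def polarFormTheta (v : Fin 3 → ℝ) (θ : ℝ) : ℝ :=
  -Real.sin θ * v 1 + Real.cos θ * v 2

theorem polarForm_mul_add (v w : Fin 3 → ℝ) (r θ : ℝ) :
    polarForm v r θ * polarForm w r θ + polarFormR v r θ * polarFormR w r θ
      + polarFormTheta v θ * polarFormTheta w θ = v 0 * w 0 + v 1 * w 1 + v 2 * w 2 := by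
  have hr := Real.sin_sq_add_cos_sq r
  have ht := Real.sin_sq_add_cos_sq θ
  simp only [polarForm, polarFormR, polarFormTheta]
  linear_combination (v 0 * w 0 + (Real.cos θ * v 1 + Real.sin θ * v 2) *
    (Real.cos θ * w 1 + Real.sin θ * w 2)) * hr + (v 1 * w 1 + v 2 * w 2) * ht

theorem contDiff_polarForm (v : Fin 3 → ℝ) :
    ContDiff ℝ 2 (fun p : ℝ × ℝ => polarForm v p.1 p.2) := by
  unfold polarForm
  fun_prop

theorem hasDerivAt_polarForm_r (v : Fin 3 → ℝ) (r θ : ℝ) :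
    HasDerivAt (fun s => polarForm v s θ) (polarFormR v r θ) r :=
  ((Real.hasDerivAt_cos r).mul_const _).add ((Real.hasDerivAt_sin r).mul_const _)

theorem hasDerivAt_polarFormR_r (v : Fin 3 → ℝ) (r θ : ℝ) :
    HasDerivAt (fun s => polarFormR v s θ) (-polarForm v r θ) r := by
  refine (((Real.hasDerivAt_sin r).neg.mul_const _).add
    ((Real.hasDerivAt_cos r).mul_const _)).congr_deriv ?_
  simp only [polarForm]
  ring

theorem hasDerivAt_polarForm_theta (v : Fin 3 → ℝ) (r θ : ℝ) :
    HasDerivAt (fun τ => polarForm v r τ) (Real.sin r * polarFormTheta v θ) θ :=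
  ((((Real.hasDerivAt_cos θ).mul_const (v 1)).add
    ((Real.hasDerivAt_sin θ).mul_const (v 2))).const_mul (Real.sin r)).const_add _

theorem hasDerivAt_polarFormR_theta (v : Fin 3 → ℝ) (r θ : ℝ) :
    HasDerivAt (fun τ => polarFormR v r τ) (Real.cos r * polarFormTheta v θ) θ :=
  ((((Real.hasDerivAt_cos θ).mul_const (v 1)).add
    ((Real.hasDerivAt_sin θ).mul_const (v 2))).const_mul (Real.cos r)).const_add _

theorem hasDerivAt_polarFormTheta (v : Fin 3 → ℝ) (r θ : ℝ) :
    HasDerivAt (polarFormTheta v)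
      (-(Real.sin r * polarForm v r θ + Real.cos r * polarFormR v r θ)) θ := by
  have hr := Real.sin_sq_add_cos_sq r
  refine (((Real.hasDerivAt_sin θ).neg.mul_const (v 1)).add
    ((Real.hasDerivAt_cos θ).mul_const (v 2))).congr_deriv ?_
  simp only [polarForm, polarFormR]
  linear_combination (Real.cos θ * v 1 + Real.sin θ * v 2) * hr

theorem hasDerivAt_eval_comp (q : ℝ[X]) {f : ℝ → ℝ} {f' t : ℝ} (hf : HasDerivAt f f' t) :
    HasDerivAt (fun s => q.eval (f s)) ((derivative q).eval (f t) * f') t :=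
  (q.hasDerivAt (f t)).comp t hf

/-- On the sphere the Hessian of a linear form `L` is `-L` times the metric, so that the Hessian of
`q(A) (κ + B)`, for linear forms `A` and `B`, follows from the product and chain rules. -/
theorem polarHessianAt_polarForm (q : ℝ[X]) (κ : ℝ) (v w : Fin 3 → ℝ) {r : ℝ} (θ : ℝ)
    (hr : Real.sin r ≠ 0) :
    polarHessianAt (fun r θ => q.eval (polarForm v r θ) * (κ + polarForm w r θ)) r θ =
      let A := polarForm v r θ
      let B := polarForm w r θ
      let A₁ := polarFormR v r θ
      let B₁ := polarFormR w r θ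
      let A₂ := polarFormTheta v θ
      let B₂ := polarFormTheta w θ
      let q₀ := q.eval A
      let q₁ := (derivative q).eval A
      let q₂ := (derivative^[2] q).eval A
      !![(κ + B) * (q₂ * A₁ ^ 2 - A * q₁) + 2 * q₁ * A₁ * B₁ - q₀ * B,
          (κ + B) * (q₂ * A₁ * A₂) + q₁ * (A₁ * B₂ + A₂ * B₁);
        (κ + B) * (q₂ * A₁ * A₂) + q₁ * (A₁ * B₂ + A₂ * B₁),
          (κ + B) * (q₂ * A₂ ^ 2 - A * q₁) + 2 * q₁ * A₂ * B₂ - q₀ * B] := by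
  have dr : ∀ r θ, HasDerivAt (fun s => q.eval (polarForm v s θ) * (κ + polarForm w s θ))
      ((derivative q).eval (polarForm v r θ) * polarFormR v r θ * (κ + polarForm w r θ) +
        q.eval (polarForm v r θ) * polarFormR w r θ) r := fun r θ =>
    (hasDerivAt_eval_comp q (hasDerivAt_polarForm_r v r θ)).mul
      ((hasDerivAt_polarForm_r w r θ).const_add κ)
  have dt : ∀ r θ, HasDerivAt (fun τ => q.eval (polarForm v r τ) * (κ + polarForm w r τ))
      ((derivative q).eval (polarForm v r θ) * (Real.sin r * polarFormTheta v θ) *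
        (κ + polarForm w r θ) +
        q.eval (polarForm v r θ) * (Real.sin r * polarFormTheta w θ)) θ := fun r θ =>
    (hasDerivAt_eval_comp q (hasDerivAt_polarForm_theta v r θ)).mul
      ((hasDerivAt_polarForm_theta w r θ).const_add κ)
  have drr := ((((hasDerivAt_eval_comp (derivative q) (hasDerivAt_polarForm_r v r θ)).mul
      (hasDerivAt_polarFormR_r v r θ)).mul ((hasDerivAt_polarForm_r w r θ).const_add κ)).add
      ((hasDerivAt_eval_comp q (hasDerivAt_polarForm_r v r θ)).mul
      (hasDerivAt_polarFormR_r w r θ))).deriv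
  have dtr := ((((hasDerivAt_eval_comp (derivative q) (hasDerivAt_polarForm_theta v r θ)).mul
      (hasDerivAt_polarFormR_theta v r θ)).mul
      ((hasDerivAt_polarForm_theta w r θ).const_add κ)).add
      ((hasDerivAt_eval_comp q (hasDerivAt_polarForm_theta v r θ)).mul
      (hasDerivAt_polarFormR_theta w r θ))).deriv
  have drt := ((((hasDerivAt_eval_comp (derivative q) (hasDerivAt_polarForm_r v r θ)).mul
      ((Real.hasDerivAt_sin r).mul_const (polarFormTheta v θ))).mul
      ((hasDerivAt_polarForm_r w r θ).const_add κ)).add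
      ((hasDerivAt_eval_comp q (hasDerivAt_polarForm_r v r θ)).mul
      ((Real.hasDerivAt_sin r).mul_const (polarFormTheta w θ)))).deriv
  have dtt := ((((hasDerivAt_eval_comp (derivative q) (hasDerivAt_polarForm_theta v r θ)).mul
      ((hasDerivAt_polarFormTheta v r θ).const_mul (Real.sin r))).mul
      ((hasDerivAt_polarForm_theta w r θ).const_add κ)).add
      ((hasDerivAt_eval_comp q (hasDerivAt_polarForm_theta v r θ)).mul
      ((hasDerivAt_polarFormTheta w r θ).const_mul (Real.sin r)))).deriv
  simp only [polarHessianAt, (dr _ _).deriv, (dt _ _).deriv]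
  simp only [Pi.add_def, Pi.mul_def] at drr dtr drt dtt
  rw [drr, dtr, drt, dtt]
  ext i j
  fin_cases i <;> fin_cases j <;>
    simp [christoffelR, christoffelTheta, Real.cot_eq_cos_div_sin] <;> field_simp <;> ring

/-! ### The Jackson kernel on the sphere -/

theorem fejerPoly_eval_cos_mul (m : ℕ) (hm : m ≠ 0) (ω : ℝ) :
    (m : ℝ) ^ 2 * (Real.sin (ω / 2) ^ 2 * (fejerPoly m).eval (Real.cos ω)) =
      Real.sin (m * ω / 2) ^ 2 := by
  have h := fejerPoly_eval_mul hm (Real.cos ω)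
  rw [T_real_cos] at h
  have h1 := Real.sin_sq_eq_half_sub (ω / 2)
  have h2 := Real.sin_sq_eq_half_sub (m * ω / 2)
  rw [mul_div_cancel₀ _ two_ne_zero] at h1 h2
  push_cast at h
  linear_combination (1 / 2 : ℝ) * h - h2 + (m : ℝ) ^ 2 * (fejerPoly m).eval (Real.cos ω) * h1

theorem contDiff_eval (q : ℝ[X]) : ContDiff ℝ 2 (fun x => q.eval x) := by
  simpa using q.contDiff_aeval (𝕜 := ℝ) 2

theorem jacksonAngle_eq (N : ℕ) (ω : ℝ) :
    jacksonAngle N ω = (jacksonPoly (N / 2 + 1)).eval (Real.cos ω) := by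
  have hm : N / 2 + 1 ≠ 0 := Nat.succ_ne_zero _
  have h := fejerPoly_eval_cos_mul _ hm ω
  rw [jacksonAngle, jacksonPoly, eval_mul]
  split_ifs with h0
  · have h1 : Real.cos ω = 1 := by
      have h2 := Real.sin_sq_eq_half_sub (ω / 2)
      rw [h0, mul_div_cancel₀ _ two_ne_zero] at h2
      linarith
    rw [h1, fejerPoly_eval_one hm, one_mul]
  · push_cast at h
    have hm' : ((N / 2 : ℕ) : ℝ) + 1 ≠ 0 := by positivity
    rw [show ∀ a : ℝ, a ^ 4 = (a ^ 2) ^ 2 from fun a => by ring,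
      show ∀ a : ℝ, a ^ 4 = (a ^ 2) ^ 2 from fun a => by ring,
      show ∀ a : ℝ, a ^ 4 = (a ^ 2) ^ 2 from fun a => by ring, ← h]
    field_simp

theorem abs_inner_le_one {x y : E3} (hx : ‖x‖ = 1) (hy : ‖y‖ = 1) : |inner ℝ x y| ≤ 1 := by
  simpa [hx, hy] using abs_real_inner_le_norm x y

theorem jackson_eq (N : ℕ) {x y : E3} (hx : ‖x‖ = 1) (hy : ‖y‖ = 1) :
    jackson N x y = (jacksonPoly (N / 2 + 1)).eval (inner ℝ x y) := by
  have h := abs_le.1 (abs_inner_le_one hx hy)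
  rw [jackson, jacksonAngle_eq, sphDist, Real.cos_arccos h.1 h.2]

theorem iteratedDeriv_two_jacksonAngle (N : ℕ) :
    iteratedDeriv 2 (jacksonAngle N) 0 = -(derivative (jacksonPoly (N / 2 + 1))).eval 1 := by
  have h1 : ∀ ω, HasDerivAt (jacksonAngle N)
      ((derivative (jacksonPoly (N / 2 + 1))).eval (Real.cos ω) * -Real.sin ω) ω := by
    intro ω
    rw [funext (jacksonAngle_eq N)]
    exact hasDerivAt_eval_comp _ (Real.hasDerivAt_cos ω)
  rw [iteratedDeriv_succ, iteratedDeriv_one, funext fun ω => (h1 ω).deriv]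
  have h2 := ((hasDerivAt_eval_comp (derivative (jacksonPoly (N / 2 + 1)))
    (Real.hasDerivAt_cos 0)).mul (Real.hasDerivAt_sin 0).neg).deriv
  simp only [Pi.mul_def, Pi.neg_def] at h2
  rw [h2]
  simp

/-- The coordinates of `v` with respect to the orthonormal basis `z`, `η z 0`, `η z 1`. -/
noncomputable def frameCoords (η : E3 → Fin 2 → E3) (z v : E3) : Fin 3 → ℝ :=
  ![inner ℝ z v, inner ℝ (η z 0) v, inner ℝ (η z 1) v]

namespace IsTangentFrame

variable {η : E3 → Fin 2 → E3}

theorem norm_eq_one (hη : IsTangentFrame η) {y : E3} (hy : ‖y‖ = 1) (k : Fin 2) :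
    ‖η y k‖ = 1 := (hη y hy).1.1 k

theorem orthonormal (hη : IsTangentFrame η) {z : E3} (hz : ‖z‖ = 1) :
    Orthonormal ℝ ![z, η z 0, η z 1] := by
  obtain ⟨h, hz'⟩ := hη z hz
  have h01 : inner ℝ (η z 0) (η z 1) = 0 := h.2 (by decide)
  rw [orthonormal_iff_ite]
  intro i j
  have h10 : inner ℝ (η z 1) (η z 0) = 0 := h.2 (by decide)
  have hz'' : ∀ k, inner ℝ (η z k) z = 0 := fun k => by rw [real_inner_comm, hz']
  fin_cases i <;> fin_cases j <;> simp [hz, hz', hz'', h.1, h01, h10]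

theorem exists_orthonormalBasis (hη : IsTangentFrame η) {z : E3} (hz : ‖z‖ = 1) :
    ∃ b : OrthonormalBasis (Fin 3) ℝ E3, ⇑b = ![z, η z 0, η z 1] := by
  have h := hη.orthonormal hz
  refine ⟨OrthonormalBasis.mk h (le_of_eq ?_), OrthonormalBasis.coe_mk _ _⟩
  exact (h.linearIndependent.span_eq_top_of_card_eq_finrank (by simp)).symm

theorem inner_eq (hη : IsTangentFrame η) {z : E3} (hz : ‖z‖ = 1) (x y : E3) :
    inner ℝ x y = inner ℝ z x * inner ℝ z y + inner ℝ (η z 0) x * inner ℝ (η z 0) y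
      + inner ℝ (η z 1) x * inner ℝ (η z 1) y := by
  obtain ⟨b, hb⟩ := hη.exists_orthonormalBasis hz
  rw [← b.sum_inner_mul_inner x y, Fin.sum_univ_three, hb]
  simp [real_inner_comm]

theorem eq_sum (hη : IsTangentFrame η) {z : E3} (hz : ‖z‖ = 1) (x : E3) :
    x = inner ℝ z x • z + inner ℝ (η z 0) x • η z 0 + inner ℝ (η z 1) x • η z 1 := by
  obtain ⟨b, hb⟩ := hη.exists_orthonormalBasis hz
  conv_lhs => rw [← b.sum_repr' x, Fin.sum_univ_three, hb]
  simp

/-- The Bessel inequality for the orthonormal pair `y`, `η y k`. -/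
theorem inner_sq_add_inner_sq_le (hη : IsTangentFrame η) {x y : E3} (hx : ‖x‖ = 1) (hy : ‖y‖ = 1)
    (k : Fin 2) : inner ℝ x y ^ 2 + inner ℝ x (η y k) ^ 2 ≤ 1 := by
  have h := hη.inner_eq hy x x
  rw [real_inner_self_eq_norm_sq, hx] at h
  rw [real_inner_comm y x, real_inner_comm (η y k) x]
  fin_cases k
  · simp only [Fin.zero_eta]
    nlinarith [sq_nonneg (inner ℝ (η y 1) x)]
  · simp only [Fin.mk_one]
    nlinarith [sq_nonneg (inner ℝ (η y 0) x)]

theorem norm_direction (hη : IsTangentFrame η) {z : E3} (hz : ‖z‖ = 1) (θ : ℝ) :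
    ‖Real.cos θ • η z 0 + Real.sin θ • η z 1‖ = 1 := by
  obtain ⟨h, -⟩ := hη z hz
  have h01 : inner ℝ (η z 0) (η z 1) = 0 := h.2 (by decide)
  rw [← sq_eq_sq₀ (norm_nonneg _) zero_le_one, norm_add_sq_real, norm_smul, norm_smul, h.1, h.1,
    real_inner_smul_left, real_inner_smul_right, h01]
  simp

theorem polarMap_eq (hη : IsTangentFrame η) {z : E3} (hz : ‖z‖ = 1) (r θ : ℝ) :
    polarMap η z r θ =
      Real.cos r • z + Real.sin r • (Real.cos θ • η z 0 + Real.sin θ • η z 1) := by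
  have h := hη.norm_direction hz θ
  simp only [polarMap, sphExp, sphGeodesic]
  set v := Real.cos θ • η z 0 + Real.sin θ • η z 1
  rw [norm_smul, h, mul_one, mul_one, Real.norm_eq_abs, Real.cos_abs, smul_smul, smul_smul]
  -- at `r = 0` the factor `|r|⁻¹` is `0`, and so is the sine in front of it
  rcases lt_trichotomy r 0 with hr | rfl | hr
  · rw [abs_of_neg hr, Real.sin_neg, inv_neg, neg_mul, mul_neg, neg_neg, mul_assoc,
      inv_mul_cancel₀ hr.ne, mul_one]
  · simp
  · rw [abs_of_pos hr, mul_assoc, inv_mul_cancel₀ hr.ne', mul_one]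

theorem inner_polarMap (hη : IsTangentFrame η) {z : E3} (hz : ‖z‖ = 1) (r θ : ℝ) (y : E3) :
    inner ℝ (polarMap η z r θ) y =
      polarForm (frameCoords η z y) r θ := by
  rw [hη.polarMap_eq hz]
  simp [polarForm, frameCoords, inner_add_left, real_inner_smul_left]
  ring

theorem polarForm_sq_add (hη : IsTangentFrame η) {y z : E3} (hy : ‖y‖ = 1) (hz : ‖z‖ = 1)
    (r θ : ℝ) : polarForm (frameCoords η z y) r θ ^ 2 + polarFormR (frameCoords η z y) r θ ^ 2
      + polarFormTheta (frameCoords η z y) θ ^ 2 = 1 := by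
  have h := hη.inner_eq hz y y
  rw [real_inner_self_eq_norm_sq, hy] at h
  have h' := polarForm_mul_add (frameCoords η z y) (frameCoords η z y) r θ
  simp only [frameCoords, Matrix.cons_val] at h' ⊢
  linarith

theorem norm_polarMap (hη : IsTangentFrame η) {z : E3} (hz : ‖z‖ = 1) (r θ : ℝ) :
    ‖polarMap η z r θ‖ = 1 := by
  have h := hη.norm_direction hz θ
  obtain ⟨-, hz'⟩ := hη z hz
  have h0 : inner ℝ z (Real.cos θ • η z 0 + Real.sin θ • η z 1) = 0 := by
    simp [inner_add_right, real_inner_smul_right, hz']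
  rw [hη.polarMap_eq hz, ← sq_eq_sq₀ (norm_nonneg _) zero_le_one, norm_add_sq_real, norm_smul,
    norm_smul, h, hz, real_inner_smul_left, real_inner_smul_right, h0]
  simp

theorem sin_polarR_eq_norm (hη : IsTangentFrame η) {x z : E3} (hx : ‖x‖ = 1) (hz : ‖z‖ = 1) :
    Real.sin (polarR z x) = ‖(⟨inner ℝ x (η z 0), inner ℝ x (η z 1)⟩ : ℂ)‖ := by
  have h := hη.inner_eq hz x x
  rw [real_inner_self_eq_norm_sq, hx] at h
  rw [polarR, sphDist, Real.sin_arccos, Complex.norm_def, Complex.normSq_mk]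
  congr 1
  rw [real_inner_comm x (η z 0), real_inner_comm x (η z 1), real_inner_comm x z] at *
  linarith

theorem polarMap_polarR_polarTheta (hη : IsTangentFrame η) {x z : E3} (hx : ‖x‖ = 1)
    (hz : ‖z‖ = 1) : polarMap η z (polarR z x) (polarTheta η z x) = x := by
  have h := abs_le.1 (abs_inner_le_one hx hz)
  have hc : Real.cos (polarR z x) = inner ℝ z x := by
    rw [polarR, sphDist, Real.cos_arccos h.1 h.2, real_inner_comm]
  rw [hη.polarMap_eq hz, hc, smul_add, smul_smul, smul_smul, hη.sin_polarR_eq_norm hx hz,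
    polarTheta, Complex.norm_mul_cos_arg, Complex.norm_mul_sin_arg]
  conv_rhs => rw [hη.eq_sum hz x]
  rw [real_inner_comm x (η z 0), real_inner_comm x (η z 1), add_assoc]

theorem sphGeodesic_eq (hη : IsTangentFrame η) {y : E3} (hy : ‖y‖ = 1) (k : Fin 2) (t : ℝ) :
    sphGeodesic y (η y k) t = Real.cos t • y + Real.sin t • η y k := by
  simp [sphGeodesic, hη.norm_eq_one hy k]

theorem norm_sphGeodesic (hη : IsTangentFrame η) {y : E3} (hy : ‖y‖ = 1) (k : Fin 2) (t : ℝ) :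
    ‖sphGeodesic y (η y k) t‖ = 1 := by
  rw [hη.sphGeodesic_eq hy, ← sq_eq_sq₀ (norm_nonneg _) zero_le_one, norm_add_sq_real, norm_smul,
    norm_smul, hη.norm_eq_one hy, hy, real_inner_smul_left, real_inner_smul_right, (hη y hy).2 k]
  simp

theorem hasDerivAt_jackson (hη : IsTangentFrame η) (N : ℕ) {x y : E3} (hx : ‖x‖ = 1)
    (hy : ‖y‖ = 1) (k : Fin 2) :
    HasDerivAt (fun t : ℝ => jackson N x (sphGeodesic y (η y k) t))
      ((derivative (jacksonPoly (N / 2 + 1))).eval (inner ℝ x y) * inner ℝ x (η y k)) 0 := by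
  have e : (fun t : ℝ => jackson N x (sphGeodesic y (η y k) t)) = fun t : ℝ =>
      (jacksonPoly (N / 2 + 1)).eval
        (Real.cos t * inner ℝ x y + Real.sin t * inner ℝ x (η y k)) := by
    funext t
    rw [jackson_eq N hx (hη.norm_sphGeodesic hy k t), hη.sphGeodesic_eq hy, inner_add_right,
      real_inner_smul_right, real_inner_smul_right]
  rw [e]
  have h := hasDerivAt_eval_comp (jacksonPoly (N / 2 + 1))
    (((Real.hasDerivAt_cos 0).mul_const (inner ℝ x y)).add
      ((Real.hasDerivAt_sin 0).mul_const (inner ℝ x (η y k))))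
  simpa using h

theorem jacksonDeriv_eq (hη : IsTangentFrame η) (N : ℕ) {x y : E3} (hx : ‖x‖ = 1) (hy : ‖y‖ = 1)
    (k : Fin 2) : jacksonDeriv N η k x y =
      (derivative (jacksonPoly (N / 2 + 1))).eval (inner ℝ x y) * inner ℝ x (η y k) :=
  (hη.hasDerivAt_jackson N hx hy k).deriv

theorem jackson_polarMap (hη : IsTangentFrame η) (N : ℕ) {y z : E3} (hy : ‖y‖ = 1) (hz : ‖z‖ = 1)
    (r θ : ℝ) : jackson N (polarMap η z r θ) y = (jacksonPoly (N / 2 + 1)).eval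
      (polarForm (frameCoords η z y) r θ) := by
  rw [jackson_eq N (hη.norm_polarMap hz r θ) hy, hη.inner_polarMap hz]

theorem jacksonDeriv_polarMap (hη : IsTangentFrame η) (N : ℕ) {y z : E3} (hy : ‖y‖ = 1)
    (hz : ‖z‖ = 1) (k : Fin 2) (r θ : ℝ) :
    jacksonDeriv N η k (polarMap η z r θ) y = (derivative (jacksonPoly (N / 2 + 1))).eval
      (polarForm (frameCoords η z y) r θ) *
      polarForm (frameCoords η z (η y k)) r θ := by
  rw [hη.jacksonDeriv_eq N (hη.norm_polarMap hz r θ) hy, hη.inner_polarMap hz,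
    hη.inner_polarMap hz]

theorem contDiff_jackson_polarMap (hη : IsTangentFrame η) (N : ℕ) {y z : E3} (hy : ‖y‖ = 1)
    (hz : ‖z‖ = 1) : ContDiff ℝ 2 (fun p : ℝ × ℝ => jackson N (polarMap η z p.1 p.2) y) := by
  simp only [hη.jackson_polarMap N hy hz]
  exact (contDiff_eval (jacksonPoly (N / 2 + 1))).comp (contDiff_polarForm _)

theorem contDiff_jacksonDeriv_polarMap (hη : IsTangentFrame η) (N : ℕ) {y z : E3} (hy : ‖y‖ = 1)
    (hz : ‖z‖ = 1) (k : Fin 2) :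
    ContDiff ℝ 2 (fun p : ℝ × ℝ => jacksonDeriv N η k (polarMap η z p.1 p.2) y) := by
  simp only [hη.jacksonDeriv_polarMap N hy hz k]
  exact ((contDiff_eval (derivative (jacksonPoly (N / 2 + 1)))).comp (contDiff_polarForm _)).mul
    (contDiff_polarForm _)

end IsTangentFrame

theorem sin_polarR_pos {x z : E3} (hx : ‖x‖ = 1) (hz : ‖z‖ = 1)
    (hxz : x ≠ z) (hxz' : x ≠ -z) : 0 < Real.sin (polarR z x) := by
  have h := abs_le.1 (abs_inner_le_one hx hz)
  apply Real.sin_pos_of_pos_of_lt_pi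
  · refine Real.arccos_pos.2 (lt_of_le_of_ne h.2 fun e => hxz ?_)
    exact (inner_eq_one_iff_of_norm_eq_one hx hz).1 e
  · refine lt_of_le_of_ne (Real.arccos_le_pi _) fun e => hxz' ?_
    have e' : inner ℝ x z ≤ -1 := Real.arccos_eq_pi.1 e
    refine (inner_eq_one_iff_of_norm_eq_one (𝕜 := ℝ) hx (by rwa [norm_neg])).1 ?_
    rw [inner_neg_right]
    linarith [h.1]

/-! ### The Hessians of the kernel and of its derivatives -/

namespace IsTangentFrame

variable {η : E3 → Fin 2 → E3}

theorem polarHessian_jackson (hη : IsTangentFrame η) (N : ℕ) {x y z : E3} (hy : ‖y‖ = 1)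
    (hz : ‖z‖ = 1) (hs : Real.sin (polarR z x) ≠ 0) :
    polarHessian η z (fun x' => jackson N x' y) x =
      let v := frameCoords η z y
      let A := polarForm v (polarR z x) (polarTheta η z x)
      let A₁ := polarFormR v (polarR z x) (polarTheta η z x)
      let A₂ := polarFormTheta v (polarTheta η z x)
      let p₁ := (derivative (jacksonPoly (N / 2 + 1))).eval A
      let p₂ := (derivative^[2] (jacksonPoly (N / 2 + 1))).eval A
      !![p₂ * A₁ ^ 2 - A * p₁, p₂ * A₁ * A₂; p₂ * A₁ * A₂, p₂ * A₂ ^ 2 - A * p₁] := by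
  have h := polarHessianAt_polarForm (jacksonPoly (N / 2 + 1)) 1
    (frameCoords η z y) 0 (polarTheta η z x) hs
  simp only [polarHessian, hη.jackson_polarMap N hy hz]
  simpa [polarForm, polarFormR, polarFormTheta] using h

theorem polarHessian_jacksonDeriv (hη : IsTangentFrame η) (N : ℕ) {x y z : E3} (hy : ‖y‖ = 1)
    (hz : ‖z‖ = 1) (hs : Real.sin (polarR z x) ≠ 0) (k : Fin 2) :
    polarHessian η z (fun x' => jacksonDeriv N η k x' y) x =
      let v := frameCoords η z y
      let w := frameCoords η z (η y k)
      let A := polarForm v (polarR z x) (polarTheta η z x)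
      let B := polarForm w (polarR z x) (polarTheta η z x)
      let A₁ := polarFormR v (polarR z x) (polarTheta η z x)
      let B₁ := polarFormR w (polarR z x) (polarTheta η z x)
      let A₂ := polarFormTheta v (polarTheta η z x)
      let B₂ := polarFormTheta w (polarTheta η z x)
      let p₁ := (derivative (jacksonPoly (N / 2 + 1))).eval A
      let p₂ := (derivative^[2] (jacksonPoly (N / 2 + 1))).eval A
      let p₃ := (derivative^[3] (jacksonPoly (N / 2 + 1))).eval A
      !![B * (p₃ * A₁ ^ 2 - A * p₂) + 2 * p₂ * A₁ * B₁ - p₁ * B,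
          B * (p₃ * A₁ * A₂) + p₂ * (A₁ * B₂ + A₂ * B₁);
        B * (p₃ * A₁ * A₂) + p₂ * (A₁ * B₂ + A₂ * B₁),
          B * (p₃ * A₂ ^ 2 - A * p₂) + 2 * p₂ * A₂ * B₂ - p₁ * B] := by
  have h := polarHessianAt_polarForm (derivative (jacksonPoly (N / 2 + 1))) 0
    (frameCoords η z y)
    (frameCoords η z (η y k))
    (polarTheta η z x) hs
  simp only [polarHessian, hη.jacksonDeriv_polarMap N hy hz k]
  simp only [zero_add] at h
  exact h

end IsTangentFrame

/-! ### Algebraic estimates of the Hessian entries -/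

theorem abs_hessian_diag_le (p₁ p₂ : ℝ) {a a₁ s : ℝ} (ha : |a| ≤ 1) (h1 : a₁ ^ 2 ≤ s ^ 2) :
    |p₂ * a₁ ^ 2 - a * p₁| ≤ s ^ 2 * |p₂| + |p₁| := by
  calc |p₂ * a₁ ^ 2 - a * p₁| ≤ |p₂ * a₁ ^ 2| + |a * p₁| := abs_sub _ _
    _ = a₁ ^ 2 * |p₂| + |a| * |p₁| := by
        rw [abs_mul, abs_mul, abs_of_nonneg (sq_nonneg a₁), mul_comm]
    _ ≤ s ^ 2 * |p₂| + 1 * |p₁| := by gcongr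
    _ = _ := by ring

theorem abs_mul_le_sq {a₁ a₂ s : ℝ} (h : a₁ ^ 2 + a₂ ^ 2 = s ^ 2) : |a₁ * a₂| ≤ s ^ 2 := by
  rw [abs_le]
  constructor <;> nlinarith [sq_nonneg (a₁ + a₂), sq_nonneg (a₁ - a₂)]

theorem abs_hessian_offDiag_le (p₂ : ℝ) {a₁ a₂ s : ℝ} (h : a₁ ^ 2 + a₂ ^ 2 = s ^ 2) :
    |p₂ * a₁ * a₂| ≤ s ^ 2 * |p₂| := by
  rw [mul_assoc, abs_mul, mul_comm]
  gcongr
  exact abs_mul_le_sq h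

theorem abs_hessianDeriv_diag_le (p₁ p₂ p₃ : ℝ) {a a₁ b b₁ s : ℝ} (ha : |a| ≤ 1) (hs : 0 ≤ s)
    (hs1 : s ≤ 1) (h1 : |a₁| ≤ s) (hb : |b| ≤ s) (hb1 : |b₁| ≤ 1) :
    |b * (p₃ * a₁ ^ 2 - a * p₂) + 2 * p₂ * a₁ * b₁ - p₁ * b| ≤
      s * (s ^ 2 * |p₃|) + 3 * (s * |p₂|) + |p₁| := by
  have h1' : a₁ ^ 2 ≤ s ^ 2 := sq_le_sq' (by linarith [(abs_le.1 h1).1]) (abs_le.1 h1).2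
  calc |b * (p₃ * a₁ ^ 2 - a * p₂) + 2 * p₂ * a₁ * b₁ - p₁ * b|
      ≤ |b * (p₃ * a₁ ^ 2 - a * p₂)| + |2 * p₂ * a₁ * b₁| + |p₁ * b| :=
        (abs_sub _ _).trans (by gcongr; exact abs_add_le _ _)
    _ = |b| * |p₃ * a₁ ^ 2 - a * p₂| + 2 * |p₂| * |a₁| * |b₁| + |p₁| * |b| := by
        simp only [abs_mul, abs_two]
    _ ≤ s * (s ^ 2 * |p₃| + |p₂|) + 2 * |p₂| * s * 1 + |p₁| * 1 := by
        have := abs_hessian_diag_le p₂ p₃ ha h1'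
        have := hb.trans hs1
        gcongr
    _ = _ := by ring

theorem abs_hessianDeriv_offDiag_le (p₂ p₃ : ℝ) {a₁ a₂ b b₁ b₂ s : ℝ} (hs : 0 ≤ s)
    (h : a₁ ^ 2 + a₂ ^ 2 = s ^ 2) (h1 : |a₁| ≤ s) (h2 : |a₂| ≤ s) (hb : |b| ≤ s)
    (hb1 : |b₁| ≤ 1) (hb2 : |b₂| ≤ 1) :
    |b * (p₃ * a₁ * a₂) + p₂ * (a₁ * b₂ + a₂ * b₁)| ≤
      s * (s ^ 2 * |p₃|) + 2 * (s * |p₂|) := by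
  have h3 : |a₁ * b₂ + a₂ * b₁| ≤ s * 1 + s * 1 := by
    refine (abs_add_le _ _).trans ?_
    rw [abs_mul, abs_mul]
    gcongr
  calc |b * (p₃ * a₁ * a₂) + p₂ * (a₁ * b₂ + a₂ * b₁)|
      ≤ |b| * |p₃ * a₁ * a₂| + |p₂| * |a₁ * b₂ + a₂ * b₁| := by
        rw [← abs_mul, ← abs_mul]
        exact abs_add_le _ _
    _ ≤ s * (s ^ 2 * |p₃|) + |p₂| * (s * 1 + s * 1) := by
        have := abs_hessian_offDiag_le p₃ h
        gcongr
    _ = _ := by ring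

/-! ### Bounds for pairwise different points -/

theorem sphDist_pos {x y : E3} (hx : ‖x‖ = 1) (hy : ‖y‖ = 1) (hxy : x ≠ y) :
    0 < sphDist x y ∧ (inner ℝ x y : ℝ) < 1 := by
  have h := abs_le.1 (abs_inner_le_one hx hy)
  have h1 : (inner ℝ x y : ℝ) < 1 :=
    lt_of_le_of_ne h.2 fun e => hxy ((inner_eq_one_iff_of_norm_eq_one hx hy).1 e)
  exact ⟨Real.arccos_pos.2 h1, h1⟩

/-- The bound `sin (d / 2) ≥ d / π` for the chord `1 - ⟨x, y⟩ = 2 sin² (d / 2)`. -/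
theorem inv_one_sub_inner_sq_le {x y : E3} (hx : ‖x‖ = 1) (hy : ‖y‖ = 1) (hxy : x ≠ y) :
    1 / (1 - inner ℝ x y) ^ 2 ≤ Real.pi ^ 4 / (4 * sphDist x y ^ 4) := by
  obtain ⟨hd, h1⟩ := sphDist_pos hx hy hxy
  have h := abs_le.1 (abs_inner_le_one hx hy)
  have hdπ : sphDist x y ≤ Real.pi := Real.arccos_le_pi _
  have hc : Real.cos (sphDist x y) = inner ℝ x y := Real.cos_arccos h.1 h.2
  have hsin := Real.mul_le_sin (x := sphDist x y / 2) (by linarith) (by linarith)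
  have hsq := Real.sin_sq_eq_half_sub (sphDist x y / 2)
  rw [mul_div_cancel₀ _ two_ne_zero, hc] at hsq
  set d := sphDist x y
  have hπ := Real.pi_pos
  have e : 2 / Real.pi * (d / 2) = d / Real.pi := by ring
  rw [e] at hsin
  have h2 : 2 * (d / Real.pi) ^ 2 ≤ 1 - inner ℝ x y := by
    have := pow_le_pow_left₀ (by positivity) hsin 2
    linarith
  calc 1 / (1 - inner ℝ x y) ^ 2 ≤ 1 / (2 * (d / Real.pi) ^ 2) ^ 2 := by gcongr
    _ = _ := by
      field_simp
      norm_num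

/-- The four combinations of derivatives of the Jackson polynomial that majorize the Hessian
entries, bounded in terms of the distance. -/
theorem jacksonPoly_bounds_sphDist (N : ℕ) {x y : E3} (hx : ‖x‖ = 1) (hy : ‖y‖ = 1)
    (hxy : x ≠ y) {m s : ℝ} (hm : m = ((N / 2 + 1 : ℕ) : ℝ)) (hs : 0 ≤ s)
    (hsx : s ^ 2 = 1 - (inner ℝ x y : ℝ) ^ 2) {p₁ p₂ p₃ : ℝ}
    (h1 : p₁ = (derivative (jacksonPoly (N / 2 + 1))).eval (inner ℝ x y))
    (h2 : p₂ = (derivative^[2] (jacksonPoly (N / 2 + 1))).eval (inner ℝ x y))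
    (h3 : p₃ = (derivative^[3] (jacksonPoly (N / 2 + 1))).eval (inner ℝ x y)) :
    s ^ 2 * |p₂| + |p₁| ≤ 16.5 * Real.pi ^ 4 / (m ^ 2 * sphDist x y ^ 4) ∧
    s ^ 2 * |p₂| ≤ 14.5 * Real.pi ^ 4 / (m ^ 2 * sphDist x y ^ 4) ∧
    s * (s ^ 2 * |p₃|) + 3 * (s * |p₂|) + |p₁| ≤ 103 * Real.pi ^ 4 / (m * sphDist x y ^ 4) ∧
    s * (s ^ 2 * |p₃|) + 2 * (s * |p₂|) ≤ 93.5 * Real.pi ^ 4 / (m * sphDist x y ^ 4) := by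
  have hlt := (sphDist_pos hx hy hxy).2
  obtain ⟨c1, c2, c3, c4⟩ :=
    jacksonPoly_derivative_bounds (Nat.add_one_ne_zero (N / 2)) (abs_inner_le_one hx hy) hlt hs hsx
  have hu := inv_one_sub_inner_sq_le hx hy hxy
  rw [← hm, ← h1] at c1
  rw [← hm, ← h2] at c2 c3
  rw [← hm, ← h3] at c4
  have hm1 : 1 ≤ m := by
    rw [hm]
    exact_mod_cast Nat.succ_le_succ (Nat.zero_le _)
  have hm0 : 0 < m := by linarith
  have hu0 : 0 < 1 - (inner ℝ x y : ℝ) := by linarith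
  clear h1 h2 h3 hsx hm
  generalize 1 - (inner ℝ x y : ℝ) = u at *
  generalize sphDist x y = d at *
  have conv : ∀ {c C t M : ℝ}, 0 ≤ C → c = C / 4 → 0 < M → t ≤ C / (M * u ^ 2) →
      t ≤ c * Real.pi ^ 4 / (M * d ^ 4) := by
    intro c C t M hC hc hM ht
    refine ht.trans ?_
    calc C / (M * u ^ 2) = C / M * (1 / u ^ 2) := by field_simp
      _ ≤ C / M * (Real.pi ^ 4 / (4 * d ^ 4)) := by gcongr
      _ = _ := by
          rw [hc]
          field_simp
  have c1' : |p₁| ≤ 8 / (m * u ^ 2) := by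
    refine c1.trans (div_le_div_of_nonneg_left (by norm_num) (by positivity) ?_)
    gcongr
    nlinarith
  refine ⟨conv (C := 66) (by norm_num) (by norm_num) (by positivity) ?_,
    conv (C := 58) (by norm_num) (by norm_num) (by positivity) c2,
    conv (C := 412) (by norm_num) (by norm_num) hm0 ?_,
    conv (C := 374) (by norm_num) (by norm_num) hm0 ?_⟩
  · refine (add_le_add c2 c1).trans_eq ?_
    ring
  · refine (add_le_add (add_le_add c4 (mul_le_mul_of_nonneg_left c3 zero_le_three)) c1').trans ?_
    rw [← mul_div_assoc, ← add_div, ← add_div]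
    gcongr
    norm_num
  · refine (add_le_add c4 (mul_le_mul_of_nonneg_left c3 zero_le_two)).trans ?_
    rw [← mul_div_assoc, ← add_div]
    gcongr
    norm_num

theorem polarHessian_bounds_of_ne {η : E3 → Fin 2 → E3} (hη : IsTangentFrame η) (N : ℕ)
    {x y z : E3} (hx : ‖x‖ = 1) (hy : ‖y‖ = 1) (hz : ‖z‖ = 1) (hxy : x ≠ y) (hxz : x ≠ z)
    (hxz' : x ≠ -z) (m : ℝ) (hm : m = ((N / 2 + 1 : ℕ) : ℝ)) :
    (∀ i : Fin 2, |polarHessian η z (fun x' => jackson N x' y) x i i| ≤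
      16.5 * Real.pi ^ 4 / (m ^ 2 * sphDist x y ^ 4)) ∧
    (∀ i j : Fin 2, i ≠ j → |polarHessian η z (fun x' => jackson N x' y) x i j| ≤
      14.5 * Real.pi ^ 4 / (m ^ 2 * sphDist x y ^ 4)) ∧
    (∀ k i : Fin 2, |polarHessian η z (fun x' => jacksonDeriv N η k x' y) x i i| ≤
      103 * Real.pi ^ 4 / (m * sphDist x y ^ 4)) ∧
    (∀ k i j : Fin 2, i ≠ j →
      |polarHessian η z (fun x' => jacksonDeriv N η k x' y) x i j| ≤
        93.5 * Real.pi ^ 4 / (m * sphDist x y ^ 4)) := by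
  have hs := (sin_polarR_pos hx hz hxz hxz').ne'
  have hA := hη.inner_polarMap hz (polarR z x) (polarTheta η z x) y
  have hB := fun k => hη.inner_polarMap hz (polarR z x) (polarTheta η z x) (η y k)
  have hAA := hη.polarForm_sq_add hy hz (polarR z x) (polarTheta η z x)
  have hBB := fun k => hη.polarForm_sq_add (hη.norm_eq_one hy k) hz (polarR z x)
    (polarTheta η z x)
  have hbes := fun k => hη.inner_sq_add_inner_sq_le hx hy k
  have hH := hη.polarHessian_jackson N hy hz hs
  have hHk := fun k => hη.polarHessian_jacksonDeriv N hy hz hs k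
  simp only [hη.polarMap_polarR_polarTheta hx hz] at hA hB
  simp only [← hA, ← hB] at hAA hBB hH hHk
  have habs := abs_inner_le_one hx hy
  obtain ⟨s, hs0, hsx⟩ : ∃ s : ℝ, 0 ≤ s ∧ s ^ 2 = 1 - (inner ℝ x y : ℝ) ^ 2 :=
    ⟨_, Real.sqrt_nonneg _, Real.sq_sqrt (sub_nonneg.2 ((sq_le_one_iff_abs_le_one _).2 habs))⟩
  obtain ⟨d2, o2, d3, o3⟩ := jacksonPoly_bounds_sphDist N hx hy hxy hm hs0 hsx rfl rfl rfl
  rw [hH]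
  simp only [hHk]
  clear hH hHk hA hB
  generalize 16.5 * Real.pi ^ 4 / (m ^ 2 * sphDist x y ^ 4) = K₁ at *
  generalize 14.5 * Real.pi ^ 4 / (m ^ 2 * sphDist x y ^ 4) = K₂ at *
  generalize 103 * Real.pi ^ 4 / (m * sphDist x y ^ 4) = K₃ at *
  generalize 93.5 * Real.pi ^ 4 / (m * sphDist x y ^ 4) = K₄ at *
  generalize (derivative (jacksonPoly (N / 2 + 1))).eval (inner ℝ x y) = p₁ at *
  generalize (derivative^[2] (jacksonPoly (N / 2 + 1))).eval (inner ℝ x y) = p₂ at *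
  generalize (derivative^[3] (jacksonPoly (N / 2 + 1))).eval (inner ℝ x y) = p₃ at *
  generalize polarFormR (frameCoords η z y) (polarR z x) (polarTheta η z x) = a₁ at *
  generalize polarFormTheta (frameCoords η z y) (polarTheta η z x) = a₂ at *
  have hb : ∀ k, |inner ℝ x (η y k)| ≤ s := fun k =>
    abs_le_of_sq_le_sq (by linarith [hbes k]) hs0
  have hb1 : ∀ k, |polarFormR (frameCoords η z (η y k)) (polarR z x) (polarTheta η z x)| ≤ 1 :=
    fun k => by
      rw [← sq_le_one_iff_abs_le_one]
      linarith [hBB k, sq_nonneg (inner ℝ x (η y k)),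
        sq_nonneg (polarFormTheta (frameCoords η z (η y k)) (polarTheta η z x))]
  have hb2 : ∀ k, |polarFormTheta (frameCoords η z (η y k)) (polarTheta η z x)| ≤ 1 :=
    fun k => by
      rw [← sq_le_one_iff_abs_le_one]
      linarith [hBB k, sq_nonneg (inner ℝ x (η y k)),
        sq_nonneg (polarFormR (frameCoords η z (η y k)) (polarR z x) (polarTheta η z x))]
  have ha : a₁ ^ 2 + a₂ ^ 2 = s ^ 2 := by linarith
  have ha1' : a₁ ^ 2 ≤ s ^ 2 := by linarith [sq_nonneg a₂]
  have ha2' : a₂ ^ 2 ≤ s ^ 2 := by linarith [sq_nonneg a₁]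
  have ha1 : |a₁| ≤ s := abs_le_of_sq_le_sq ha1' hs0
  have ha2 : |a₂| ≤ s := abs_le_of_sq_le_sq ha2' hs0
  have hs1 : s ≤ 1 := by nlinarith [sq_nonneg (inner ℝ x y : ℝ)]
  simp only [Fin.forall_fin_two, Matrix.of_apply, Matrix.cons_val, ne_eq, not_true_eq_false,
    zero_ne_one, one_ne_zero, not_false_eq_true, IsEmpty.forall_iff, true_and, and_true,
    forall_const]
  have D1 := abs_hessian_diag_le p₁ p₂ habs ha1'
  have D2 := abs_hessian_diag_le p₁ p₂ habs ha2'
  have O := abs_hessian_offDiag_le p₂ ha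
  have D3 := fun k => abs_hessianDeriv_diag_le p₁ p₂ p₃ habs hs0 hs1 ha1 (hb k) (hb1 k)
  have D4 := fun k => abs_hessianDeriv_diag_le p₁ p₂ p₃ habs hs0 hs1 ha2 (hb k) (hb2 k)
  have O' := fun k => abs_hessianDeriv_offDiag_le p₂ p₃ hs0 ha ha1 ha2 (hb k) (hb1 k) (hb2 k)
  exact ⟨⟨D1.trans d2, D2.trans d2⟩, ⟨O.trans o2, O.trans o2⟩,
    ⟨⟨(D3 0).trans d3, (D4 0).trans d3⟩, ⟨(D3 1).trans d3, (D4 1).trans d3⟩⟩,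
    ⟨⟨(O' 0).trans o3, (O' 0).trans o3⟩, ⟨(O' 1).trans o3, (O' 1).trans o3⟩⟩⟩

/-! ### Bounds near the centre -/

namespace IsTangentFrame

variable {η : E3 → Fin 2 → E3}

theorem frameCoords_self (hη : IsTangentFrame η) {z : E3} (hz : ‖z‖ = 1) :
    frameCoords η z z = ![1, 0, 0] := by
  simp [frameCoords, real_inner_comm z, (hη z hz).2, hz]

theorem polarHessian_jackson_centre (hη : IsTangentFrame η) (N : ℕ) {x z : E3} (hz : ‖z‖ = 1)
    (hs : Real.sin (polarR z x) ≠ 0) :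
    polarHessian η z (fun x' => jackson N x' z) x =
      let A := Real.cos (polarR z x)
      let p₁ := (derivative (jacksonPoly (N / 2 + 1))).eval A
      let p₂ := (derivative^[2] (jacksonPoly (N / 2 + 1))).eval A
      !![p₂ * Real.sin (polarR z x) ^ 2 - A * p₁, 0; 0, -(A * p₁)] := by
  have hH := hη.polarHessian_jackson N hz hz hs
  simp only [hη.frameCoords_self hz] at hH
  rw [hH]
  simp [polarForm, polarFormR, polarFormTheta]

/-- Here `c` and `c'` are the cosine and, up to sign, the sine of the angle between `η z k` and
the direction of the geodesic from `z` to `x`. -/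
theorem polarHessian_jacksonDeriv_centre (hη : IsTangentFrame η) (N : ℕ) {x z : E3} (hz : ‖z‖ = 1)
    (hs : Real.sin (polarR z x) ≠ 0) (k : Fin 2) :
    ∃ c c' : ℝ, |c| ≤ 1 ∧ |c'| ≤ 1 ∧
      polarHessian η z (fun x' => jacksonDeriv N η k x' z) x =
        let A := Real.cos (polarR z x)
        let S := Real.sin (polarR z x)
        let p₁ := (derivative (jacksonPoly (N / 2 + 1))).eval A
        let p₂ := (derivative^[2] (jacksonPoly (N / 2 + 1))).eval A
        let p₃ := (derivative^[3] (jacksonPoly (N / 2 + 1))).eval A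
        !![c * (S * (S ^ 2 * p₃ - 3 * A * p₂ - p₁)), c' * (S * p₂);
          c' * (S * p₂), c * (S * (-A * p₂ - p₁))] := by
  have hH := hη.polarHessian_jacksonDeriv N hz hz hs k
  have hw : frameCoords η z (η z k) 0 = 0 := by
    simp [frameCoords, (hη z hz).2 k]
  have hww := hη.polarForm_sq_add (hη.norm_eq_one hz k) hz 0 (polarTheta η z x)
  simp only [polarForm, polarFormR, hw, Real.cos_zero, Real.sin_zero] at hww
  refine ⟨Real.cos (polarTheta η z x) * frameCoords η z (η z k) 1 +
    Real.sin (polarTheta η z x) * frameCoords η z (η z k) 2,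
    -polarFormTheta (frameCoords η z (η z k)) (polarTheta η z x), ?_, ?_, ?_⟩
  · rw [← sq_le_one_iff_abs_le_one]
    nlinarith [sq_nonneg (polarFormTheta (frameCoords η z (η z k)) (polarTheta η z x))]
  · rw [← sq_le_one_iff_abs_le_one]
    nlinarith [sq_nonneg (Real.cos (polarTheta η z x) * frameCoords η z (η z k) 1 +
      Real.sin (polarTheta η z x) * frameCoords η z (η z k) 2)]
  · simp only [hη.frameCoords_self hz] at hH
    rw [hH]
    ext i j
    fin_cases i <;> fin_cases j <;> simp [polarForm, polarFormR, polarFormTheta, hw] <;> ring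

end IsTangentFrame

/-- The left side of the first bound is the fourth derivative at `0` of the kernel in the angle. -/
theorem jacksonPoly_eval_one_bounds (N : ℕ) (m : ℝ) (hm : m = ((N / 2 + 1 : ℕ) : ℝ)) :
    (derivative (jacksonPoly (N / 2 + 1))).eval 1 +
        3 * (derivative^[2] (jacksonPoly (N / 2 + 1))).eval 1 ≤ 3 / 10 * m ^ 4 ∧
      (derivative (jacksonPoly (N / 2 + 1))).eval 1 +
        (derivative^[2] (jacksonPoly (N / 2 + 1))).eval 1 ≤ 1 / 10 * m ^ 4 := by
  have hm1 : 1 ≤ m := by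
    rw [hm]
    exact_mod_cast Nat.succ_le_succ (Nat.zero_le _)
  rw [derivative_jacksonPoly_eval_one (Nat.succ_ne_zero _),
    derivative_two_jacksonPoly_eval_one (Nat.succ_ne_zero _), ← hm]
  constructor <;> nlinarith

theorem polarHessian_bounds_centre {η : E3 → Fin 2 → E3} (hη : IsTangentFrame η) (N : ℕ)
    {x z : E3} {δ : ℝ} (hx : ‖x‖ = 1) (hz : ‖z‖ = 1) (hxz : x ≠ z) (hxz' : x ≠ -z)
    (hδ : δ ≤ Real.pi / 4) (m : ℝ) (hm : m = ((N / 2 + 1 : ℕ) : ℝ)) (hd : sphDist x z ≤ δ / m) :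
    (∀ i : Fin 2, |iteratedDeriv 2 (jacksonAngle N) 0 -
        polarHessian η z (fun x' => jackson N x' z) x i i| ≤ 3 / 20 * δ ^ 2 * m ^ 2) ∧
    (∀ i j : Fin 2, i ≠ j → |polarHessian η z (fun x' => jackson N x' z) x i j| ≤
      3 / 20 * δ ^ 2 * m ^ 2) ∧
    (∀ k : Fin 2,
      |polarHessian η z (fun x' => jacksonDeriv N η k x' z) x 0 0| ≤ 3 / 10 * δ * m ^ 3 ∧
      |polarHessian η z (fun x' => jacksonDeriv N η k x' z) x 1 1| ≤ 1 / 5 * δ * m ^ 3 ∧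
      ∀ i j : Fin 2, i ≠ j →
        |polarHessian η z (fun x' => jacksonDeriv N η k x' z) x i j| ≤ 1 / 5 * δ * m ^ 3) := by
  have hm1 : 1 ≤ m := by
    rw [hm]
    exact_mod_cast Nat.succ_le_succ (Nat.zero_le _)
  have hm0 : 0 < m := by linarith
  have hs := sin_polarR_pos hx hz hxz hxz'
  have hr0 : 0 < polarR z x := (sphDist_pos hx hz hxz).1
  have hrδ : polarR z x * m ≤ δ := (le_div_iff₀ hm0).1 hd
  have hcos0 : 0 ≤ Real.cos (polarR z x) := by
    apply Real.cos_nonneg_of_neg_pi_div_two_le_of_le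
    · linarith [Real.pi_pos]
    · nlinarith [Real.pi_pos]
  have hcos := Real.abs_cos_le_one (polarR z x)
  have hcr := Real.one_sub_sq_div_two_le_cos (x := polarR z x)
  have hsr := Real.sin_le hr0.le
  have hsq := Real.sin_sq (polarR z x)
  have hJ := jacksonPoly_mem (N / 2 + 1)
  have hJ1 := chebyshevCone.derivative_mem hJ
  have hJ2 : derivative^[2] (jacksonPoly (N / 2 + 1)) ∈ chebyshevCone :=
    chebyshevCone.derivative_mem hJ1
  have b1 := chebyshevCone.abs_eval_le hJ1 hcos
  have b2 := chebyshevCone.abs_eval_le hJ2 hcos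
  have b3 : _ ≤ _ * (derivative^[2] (jacksonPoly (N / 2 + 1))).eval 1 :=
    chebyshevCone.eval_one_sub_eval_le hJ1 hcos
  have b4 := chebyshevCone.abs_thirdOrder_le hJ hcos
  rw [← hsq] at b4
  have n1 := chebyshevCone.eval_one_nonneg hJ1
  have n2 := chebyshevCone.eval_one_nonneg hJ2
  obtain ⟨e1, e2⟩ := jacksonPoly_eval_one_bounds N m hm
  rw [hη.polarHessian_jackson_centre N hz hs.ne', iteratedDeriv_two_jacksonAngle]
  have hHk := fun k => hη.polarHessian_jacksonDeriv_centre N hz hs.ne' k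
  dsimp only at hHk ⊢
  generalize (derivative (jacksonPoly (N / 2 + 1))).eval 1 = P₁ at *
  generalize (derivative^[2] (jacksonPoly (N / 2 + 1))).eval 1 = P₂ at *
  generalize (derivative (jacksonPoly (N / 2 + 1))).eval (Real.cos (polarR z x)) = p₁ at *
  generalize (derivative^[2] (jacksonPoly (N / 2 + 1))).eval (Real.cos (polarR z x)) = p₂ at *
  generalize (derivative^[3] (jacksonPoly (N / 2 + 1))).eval (Real.cos (polarR z x)) = p₃ at *
  generalize Real.cos (polarR z x) = A at *
  generalize Real.sin (polarR z x) = S at *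
  generalize polarR z x = r at *
  have hA1 : A ≤ 1 := (abs_le.1 hcos).2
  have hδ0 : 0 < δ := lt_of_lt_of_le (by positivity) hrδ
  -- in both cases the powers of the radius are turned into powers of `δ` by `r * m ≤ δ`
  have main2 : ∀ t, |t| ≤ (1 - A) * (P₁ + 3 * P₂) → |t| ≤ 3 / 20 * δ ^ 2 * m ^ 2 := by
    intro t ht
    calc |t| ≤ (1 - A) * (P₁ + 3 * P₂) := ht
      _ ≤ (r ^ 2 / 2) * (3 / 10 * m ^ 4) := by
          gcongr
          linarith
      _ = 3 / 20 * (r * m) ^ 2 * m ^ 2 := by ring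
      _ ≤ 3 / 20 * δ ^ 2 * m ^ 2 := by gcongr
  have main3 : ∀ c t B K, |c| ≤ 1 → |t| ≤ B → B ≤ K * m ^ 4 → 0 ≤ K →
      |c * (S * t)| ≤ K * δ * m ^ 3 := by
    intro c t B K hc ht hB hK
    rw [abs_mul, abs_mul, abs_of_pos hs]
    calc |c| * (S * |t|) ≤ 1 * (r * (K * m ^ 4)) := by
          have := ht.trans hB
          gcongr
      _ = K * (r * m) * m ^ 3 := by ring
      _ ≤ K * δ * m ^ 3 := by gcongr
  obtain ⟨b1l, b1r⟩ := abs_le.1 b1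
  obtain ⟨b2l, b2r⟩ := abs_le.1 b2
  have hAp : A * p₁ ≤ P₁ :=
    (mul_le_mul_of_nonneg_left b1r hcos0).trans (mul_le_of_le_one_left n1 hA1)
  have hAP : P₁ - A * p₁ ≤ (1 - A) * (P₁ + P₂) := by
    nlinarith [mul_le_mul_of_nonneg_left b3 hcos0, mul_nonneg (sub_nonneg.2 hA1) n2]
  -- `sin² r = (1 - cos r) (1 + cos r) ≤ 2 (1 - cos r)`
  have hS2 : |p₂ * S ^ 2| ≤ (1 - A) * (2 * P₂) := by
    have h : S ^ 2 ≤ (1 - A) * 2 := by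
      rw [hsq]
      nlinarith
    rw [abs_mul, abs_of_nonneg (sq_nonneg S)]
    calc |p₂| * S ^ 2 ≤ P₂ * ((1 - A) * 2) := by gcongr
      _ = _ := by ring
  obtain ⟨hS2l, hS2r⟩ := abs_le.1 hS2
  have hAP1 : 0 ≤ (1 - A) * P₁ := mul_nonneg (sub_nonneg.2 hA1) n1
  have hAP2 : 0 ≤ (1 - A) * P₂ := mul_nonneg (sub_nonneg.2 hA1) n2
  have z2 : (0 : ℝ) ≤ 3 / 20 * δ ^ 2 * m ^ 2 := by positivity
  refine ⟨?_, ?_, fun k => ?_⟩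
  · simp only [Fin.forall_fin_two, Matrix.of_apply, Matrix.cons_val]
    refine ⟨main2 _ (abs_le.2 ⟨?_, ?_⟩), main2 _ (abs_le.2 ⟨?_, ?_⟩)⟩ <;> linarith
  · simpa [Fin.forall_fin_two] using z2
  · obtain ⟨c, c', hc, hc', h⟩ := hHk k
    rw [h]
    have h11 := main3 c _ _ (3 / 10) hc b4 (by linarith) (by norm_num)
    have h12 := main3 c' _ _ (1 / 5) hc' b2 (by linarith [pow_pos hm0 4]) (by norm_num)
    have h22 := main3 c (-A * p₂ - p₁) (P₂ + P₁) (1 / 5) hc (by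
      refine (abs_sub _ _).trans (add_le_add ?_ b1)
      rw [abs_mul, abs_neg]
      exact (mul_le_of_le_one_left (abs_nonneg _) hcos).trans b2)
      (by linarith [pow_pos hm0 4]) (by norm_num)
    refine ⟨by simpa using h11, by simpa using h22, ?_⟩
    simpa [Fin.forall_fin_two] using h12

end

theorem mainTheorem6 (N n : ℕ) (hn : n = N / 2) (η : E3 → Fin 2 → E3) (hη : IsTangentFrame η) :
    -- all the derivatives below exist
    (ContDiff ℝ 2 (jacksonAngle N) ∧
      (∀ x y : E3, ‖x‖ = 1 → ‖y‖ = 1 → ∀ k : Fin 2,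
        DifferentiableAt ℝ (fun t : ℝ => jackson N x (sphGeodesic y (η y k) t)) 0) ∧
      (∀ y z : E3, ‖y‖ = 1 → ‖z‖ = 1 →
        ContDiff ℝ 2 (fun p : ℝ × ℝ => jackson N (polarMap η z p.1 p.2) y) ∧
        ∀ k : Fin 2,
          ContDiff ℝ 2 (fun p : ℝ × ℝ => jacksonDeriv N η k (polarMap η z p.1 p.2) y))) ∧
    -- the bounds for pairwise different points
    (∀ x y z : E3, ‖x‖ = 1 → ‖y‖ = 1 → ‖z‖ = 1 → x ≠ y → x ≠ z → y ≠ z → x ≠ -z →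
      (∀ i : Fin 2, |polarHessian η z (fun x' => jackson N x' y) x i i| ≤
        16.5 * Real.pi ^ 4 / (((n : ℝ) + 1) ^ 2 * sphDist x y ^ 4)) ∧
      (∀ i j : Fin 2, i ≠ j → |polarHessian η z (fun x' => jackson N x' y) x i j| ≤
        14.5 * Real.pi ^ 4 / (((n : ℝ) + 1) ^ 2 * sphDist x y ^ 4)) ∧
      (∀ k i : Fin 2, |polarHessian η z (fun x' => jacksonDeriv N η k x' y) x i i| ≤
        103 * Real.pi ^ 4 / (((n : ℝ) + 1) * sphDist x y ^ 4)) ∧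
      (∀ k i j : Fin 2, i ≠ j →
        |polarHessian η z (fun x' => jacksonDeriv N η k x' y) x i j| ≤
          93.5 * Real.pi ^ 4 / (((n : ℝ) + 1) * sphDist x y ^ 4))) ∧
    -- the bounds near the centre, for `y = z`
    (∀ (x z : E3) (δ : ℝ), ‖x‖ = 1 → ‖z‖ = 1 → x ≠ z → x ≠ -z → δ ≤ Real.pi / 4 →
      sphDist x z ≤ δ / ((n : ℝ) + 1) →
      (∀ i : Fin 2, |iteratedDeriv 2 (jacksonAngle N) 0 -
          polarHessian η z (fun x' => jackson N x' z) x i i| ≤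
        3 / 20 * δ ^ 2 * ((n : ℝ) + 1) ^ 2) ∧
      (∀ i j : Fin 2, i ≠ j → |polarHessian η z (fun x' => jackson N x' z) x i j| ≤
        3 / 20 * δ ^ 2 * ((n : ℝ) + 1) ^ 2) ∧
      (∀ k : Fin 2,
        |polarHessian η z (fun x' => jacksonDeriv N η k x' z) x 0 0| ≤
            3 / 10 * δ * ((n : ℝ) + 1) ^ 3 ∧
        |polarHessian η z (fun x' => jacksonDeriv N η k x' z) x 1 1| ≤
            1 / 5 * δ * ((n : ℝ) + 1) ^ 3 ∧
        ∀ i j : Fin 2, i ≠ j →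
          |polarHessian η z (fun x' => jacksonDeriv N η k x' z) x i j| ≤
            1 / 5 * δ * ((n : ℝ) + 1) ^ 3)) := by
  subst hn
  have hm : ((N / 2 : ℕ) : ℝ) + 1 = ((N / 2 + 1 : ℕ) : ℝ) := by push_cast; rfl
  refine ⟨⟨?_, fun x y hx hy k => (hη.hasDerivAt_jackson N hx hy k).differentiableAt,
    fun y z hy hz => ⟨hη.contDiff_jackson_polarMap N hy hz,
      fun k => hη.contDiff_jacksonDeriv_polarMap N hy hz k⟩⟩,
    fun x y z hx hy hz hxy hxz _ hxz' =>
      polarHessian_bounds_of_ne hη N hx hy hz hxy hxz hxz' _ hm,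
    fun x z δ hx hz hxz hxz' hδ hd =>
      polarHessian_bounds_centre hη N hx hz hxz hxz' hδ _ hm hd⟩
  rw [funext (jacksonAngle_eq N)]
  exact (contDiff_eval _).comp Real.contDiff_cos
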